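/- Let $T=(V,E)$ be a finite tree with $n=|V|$ vertices (unrooted). A linear arrangement of $T$ is a bijection $\pi:V\to\{1,\dots,n\}$; it is planar if no two edges $\{s,t\},\{u,v\}\in E$ cross, i.e. satisfy $\pi(s)<\pi(u)<\pi(t)<\pi(v)$. Let $D_\pi(T)=\sum_{uv\in E}|\pi(u)-\pi(v)|$ and let $\mathbb{E}_{\mathrm{pl}}[D(T)]$ be the expected value of $D_\pi(T)$ for $\pi$ uniformly random among the planar arrangements of $T$. Write $\Gamma(v)$ for the set of neighbours of $v$, $\deg(v)=|\Gamma(v)|$, and $n_v(u)$ for the number of vertices of the subtree at $u$ when $T$ is rooted at $v$, i.e. the number of $w\in V$ such that $u$ lies on the path from $v$ to $w$. Then $$\mathbb{E}_{\mathrm{pl}}[D(T)]=\frac{(n-1)(3n^2+2n-2)}{6n}-\frac{1}{6n}\sum_{v\in V}(2\deg(v)-1)\sum_{u\in\Gamma(v)}n_v(u)^2 .$$ Moreover, $\mathbb{E}_{\mathrm{pl}}[D(T)]$ can be computed in linear time: there is a single random access machine program that, given $n$ and any list of the edges of an $n$-vertex tree $T$ on $\{0,\dots,n-1\}$, outputs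 natural numbers $a$ and $b\neq 0$ with $\mathbb{E}_{\mathrm{pl}}[D(T)]=a/b$ after $O(n)$ steps, where one step is one addition, truncated subtraction, multiplication, assignment, memory or input access, or jump, and all register contents stay bounded by a polynomial in $n$ (words of $O(\log n)$ bits). -/

import Mathlib

/-! ### Linear arrangements of a tree -/

namespace PlanarLin

/-- A linear arrangement: a bijection from the vertices to `n` consecutive positions
(numbered from `0`; only the order and the differences of the positions matter). -/
abbrev Arrangement (V : Type*) [Fintype V] := V ≃ Fin (Fintype.card V)

variable {V : Type*} [Fintype V] [DecidableEq V]

/-- The number of edge crossings of the arrangement `π`. Every crossing pair of edges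
`{s,t}`, `{u,v}` is counted once, through the unique naming of the four ends with
`π s < π u < π t < π v`. -/
def numCrossings (T : SimpleGraph V) [DecidableRel T.Adj] (π : Arrangement V) : ℕ :=
  (Finset.univ.filter fun q : (V × V) × (V × V) =>
    T.Adj q.1.1 q.1.2 ∧ T.Adj q.2.1 q.2.2 ∧
      π q.1.1 < π q.2.1 ∧ π q.2.1 < π q.1.2 ∧ π q.1.2 < π q.2.2).card

/-- The finite set of planar (crossing-free) arrangements. -/
def planarArrangements (T : SimpleGraph V) [DecidableRel T.Adj] : Finset (Arrangement V) :=
  Finset.univ.filter fun π => numCrossings T π = 0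

/-- The length `|π u - π v|` of the pair `uv` in the arrangement `π`. -/
def edgeLength (π : Arrangement V) : Sym2 V → ℚ :=
  Sym2.lift ⟨fun u v => |((π u : ℕ) : ℚ) - ((π v : ℕ) : ℚ)|, fun _ _ => abs_sub_comm _ _⟩

/-- The sum `D` of the edge lengths in the arrangement `π`. -/
def sumEdgeLengths (T : SimpleGraph V) [DecidableRel T.Adj] (π : Arrangement V) : ℚ :=
  ∑ e ∈ T.edgeFinset, edgeLength π e

/-- The expected value of `D` in a uniformly random planar arrangement. -/
def expectedPlanarD (T : SimpleGraph V) [DecidableRel T.Adj] : ℚ :=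
  Finset.expect (planarArrangements T) fun π => sumEdgeLengths T π

/-- The directional size `n_r(u)`: the number of vertices of the subtree at `u` when the tree
is rooted at `r`, that is, of the `w` such that `u` is on the path from the root `r` to `w`. -/
noncomputable def subtreeSize {V : Type*} (T : SimpleGraph V) (r u : V) : ℕ :=
  {w : V | ∃ p : T.Walk r w, p.IsPath ∧ u ∈ p.support}.ncard

/-! ### A random access machine -/

/-- Instructions of a random access machine with registers `R[0], R[1], …` that hold natural
numbers and with a read-only input array `I`. -/
inductive Instr where
  /-- `R[d] := k` -/
  | const (d k : ℕ)
  /-- `R[d] := R[a] + R[b]` -/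
  | add (d a b : ℕ)
  /-- `R[d] := R[a] - R[b]`, truncated at `0` -/
  | sub (d a b : ℕ)
  /-- `R[d] := R[a] * R[b]` -/
  | mul (d a b : ℕ)
  /-- `R[d] := R[R[a]]` -/
  | load (d a : ℕ)
  /-- `R[R[a]] := R[b]` -/
  | store (a b : ℕ)
  /-- `R[d] := I[R[a]]`, which is `0` beyond the end of the input -/
  | read (d a : ℕ)
  /-- go to instruction `l` -/
  | jump (l : ℕ)
  /-- go to instruction `l` if `R[a] = 0` -/
  | jumpZero (a l : ℕ)

/-- A configuration: the program counter and the registers. -/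
structure Config where
  pc : ℕ
  reg : ℕ → ℕ

/-- The initial configuration: first instruction, all registers zero. -/
def Config.init : Config := ⟨0, fun _ => 0⟩

/-- The effect of one instruction on input `I`. -/
def Instr.exec (I : List ℕ) (c : Config) : Instr → Config
  | .const d k => ⟨c.pc + 1, Function.update c.reg d k⟩
  | .add d a b => ⟨c.pc + 1, Function.update c.reg d (c.reg a + c.reg b)⟩
  | .sub d a b => ⟨c.pc + 1, Function.update c.reg d (c.reg a - c.reg b)⟩
  | .mul d a b => ⟨c.pc + 1, Function.update c.reg d (c.reg a * c.reg b)⟩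
  | .load d a => ⟨c.pc + 1, Function.update c.reg d (c.reg (c.reg a))⟩
  | .store a b => ⟨c.pc + 1, Function.update c.reg (c.reg a) (c.reg b)⟩
  | .read d a => ⟨c.pc + 1, Function.update c.reg d (I.getD (c.reg a) 0)⟩
  | .jump l => ⟨l, c.reg⟩
  | .jumpZero a l => ⟨if c.reg a = 0 then l else c.pc + 1, c.reg⟩

/-- One step of the program `P` on input `I`. The machine has halted, and the configuration
does not change any more, once the program counter is outside the program. -/
def step (P : List Instr) (I : List ℕ) (c : Config) : Config :=
  match P[c.pc]? with
  | some i => i.exec I c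
  | none => c

/-- The configuration after `t` steps of the program `P` on input `I`. -/
def runFor (P : List Instr) (I : List ℕ) (t : ℕ) : Config :=
  (step P I)^[t] Config.init

/-- On input `I` the program `P` halts after at most `time` steps with `a` in register `0`
and `b` in register `1`, and no register ever exceeds `bound`. -/
def ComputesWithin (P : List Instr) (I : List ℕ) (time bound a b : ℕ) : Prop :=
  P.length ≤ (runFor P I time).pc ∧
  (runFor P I time).reg 0 = a ∧ (runFor P I time).reg 1 = b ∧
  ∀ t r, (runFor P I t).reg r ≤ bound

/-- `L` lists every edge of `T` exactly once, in any order and with its ends in any order. -/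
def IsEdgeList {n : ℕ} (T : SimpleGraph (Fin n)) (L : List (Fin n × Fin n)) : Prop :=
  (L.map fun e => s(e.1, e.2)).Nodup ∧
  ∀ e : Sym2 (Fin n), e ∈ L.map (fun e => s(e.1, e.2)) ↔ e ∈ T.edgeSet

/-- The input array of the machine: the number `n` of vertices, followed by the two ends of
each edge in turn. -/
def encodeInput {n : ℕ} (L : List (Fin n × Fin n)) : List ℕ :=
  n :: L.flatMap fun e => [(e.1 : ℕ), (e.2 : ℕ)]

end PlanarLin

/-! Rotating a planar arrangement cyclically keeps it planar, so the planar arrangements are the `n`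
rotations of those with a given vertex `u` in the first position. Over the rotations of such an
arrangement, an edge `uv` whose ends are `d` positions apart has average length `2 d (n - d) / n`,
and `d (n - d)` is determined by the number of pairs `{x, y}` that `u` and `v` separate on the
circle. With `u` first, every branch at `u` is an interval, and the branches can be permuted and
reversed. Two vertices that lie behind different neighbours of `u` other than `v` are thus separated
with probability `1 / 3`, two vertices behind the same neighbour never, and by symmetry the same
holds behind `v`. Two vertices on different sides of `uv` are separated with probability `1 / 2`, as
reversing the branch that contains `v` shows. Summing over all edges gives the formula.

For the machine, the two directional sizes of an edge add up to `n`, and when a leaf is cut off,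
the part of the tree on its side consists of this leaf and all that has been cut off behind it. So
every vertex keeps the size of this part and the sum of its remaining neighbours, which for a leaf
is its neighbour itself. -/

namespace PlanarLin

/-! ### Branches of a tree at a vertex -/

section Branch

variable {V : Type*} {T : SimpleGraph V}

open Classical in
/-- The second vertex of a path from `u` to `w`: for `w ≠ u`, the neighbour of `u` whose branch
contains `w`. By convention `branch T u u = u` in a tree. -/
noncomputable def branch (T : SimpleGraph V) (u w : V) : V :=
  if h : ∃ p : T.Walk u w, p.IsPath then h.choose.snd else u

theorem branch_eq_snd (hT : T.IsTree) {u w : V} {p : T.Walk u w} (hp : p.IsPath) :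
    branch T u w = p.snd := by
  have h : ∃ p : T.Walk u w, p.IsPath := ⟨p, hp⟩
  rw [branch, dif_pos h, (hT.existsUnique_path u w).unique h.choose_spec hp]

theorem branch_self (hT : T.IsTree) (u : V) : branch T u u = u :=
  branch_eq_snd hT (p := .nil) .nil

theorem adj_branch (hT : T.IsTree) {u w : V} (h : w ≠ u) : T.Adj u (branch T u w) := by
  obtain ⟨p, hp, -⟩ := hT.existsUnique_path u w
  rw [branch_eq_snd hT hp]
  exact p.adj_snd (SimpleGraph.Walk.not_nil_of_ne h.symm)

theorem branch_eq_self_iff (hT : T.IsTree) {u w : V} : branch T u w = u ↔ w = u := by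
  refine ⟨fun h => ?_, fun h => h ▸ branch_self hT _⟩
  by_contra hne
  exact (adj_branch hT hne).ne h.symm

theorem branch_eq_iff_mem_support (hT : T.IsTree) {u c w : V} (hc : T.Adj u c) :
    branch T u w = c ↔ ∃ p : T.Walk u w, p.IsPath ∧ c ∈ p.support := by
  constructor
  · rintro rfl
    obtain ⟨p, hp, -⟩ := hT.existsUnique_path u w
    exact ⟨p, hp, branch_eq_snd hT hp ▸ p.getVert_mem_support 1⟩
  · rintro ⟨p, hp, hm⟩
    rw [branch_eq_snd hT hp]
    exact (hT.2.eq_snd_of_adj_start hp hc hm).symm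

theorem branch_of_adj (hT : T.IsTree) {u c : V} (hc : T.Adj u c) : branch T u c = c := by
  obtain ⟨p, hp, -⟩ := hT.existsUnique_path u c
  exact (branch_eq_iff_mem_support hT hc).2 ⟨p, hp, p.end_mem_support⟩

theorem branch_branch (hT : T.IsTree) (u w : V) : branch T u (branch T u w) = branch T u w := by
  by_cases hw : w = u
  · rw [(branch_eq_self_iff hT).2 hw, branch_self hT]
  · exact branch_of_adj hT (adj_branch hT hw)

theorem branch_eq_of_adj (hT : T.IsTree) {u x y : V} (hx : x ≠ u) (hy : y ≠ u)
    (hxy : T.Adj x y) : branch T u x = branch T u y := by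
  classical
  obtain ⟨p, hp, -⟩ := hT.existsUnique_path u x
  by_cases hm : y ∈ p.support
  · rw [branch_eq_snd hT hp, branch_eq_snd hT (hp.takeUntil hm), p.snd_takeUntil hy hm]
  · refine ((branch_eq_iff_mem_support hT (adj_branch hT hx)).2 ⟨_, hp.concat hm hxy, ?_⟩).symm
    rw [SimpleGraph.Walk.support_concat, branch_eq_snd hT hp]
    exact List.mem_append_left _ (p.getVert_mem_support 1)

theorem branch_eq_of_notMem_support (hT : T.IsTree) {u a b : V} (p : T.Walk a b)
    (hu : u ∉ p.support) : branch T u a = branch T u b := by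
  induction p with
  | nil => rfl
  | cons hadj q ih =>
    rw [SimpleGraph.Walk.support_cons, List.mem_cons, not_or] at hu
    rw [← ih hu.2]
    exact branch_eq_of_adj hT (Ne.symm hu.1) (fun h => hu.2 (h ▸ q.start_mem_support)) hadj

theorem exists_isPath_forall_branch_eq (hT : T.IsTree) {u w : V} (hw : w ≠ u) :
    ∃ p : T.Walk (branch T u w) w, p.IsPath ∧ ∀ x ∈ p.support, branch T u x = branch T u w := by
  classical
  obtain ⟨p, hp, -⟩ := hT.existsUnique_path u w
  cases p with
  | nil => exact absurd rfl hw
  | @cons _ c _ h q =>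
    have hb : branch T u w = c := (branch_eq_snd hT hp).trans (q.snd_cons h)
    rw [SimpleGraph.Walk.cons_isPath_iff] at hp
    rw [hb]
    refine ⟨q, hp.1, fun x hx => ?_⟩
    rw [← branch_eq_of_notMem_support hT (q.takeUntil x hx)
      fun hu => hp.2 (q.support_takeUntil_subset_support hx hu), branch_of_adj hT h]

theorem branch_eq_iff_branch_ne (hT : T.IsTree) {u v : V} (h : T.Adj u v) (w : V) :
    branch T u w = v ↔ branch T v w ≠ u := by
  constructor
  · intro hb hu
    have hwu : w ≠ u := fun hwu => h.ne ((branch_eq_self_iff hT).2 hwu ▸ hb)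
    obtain ⟨p, hp, hpu⟩ := exists_isPath_forall_branch_eq hT hwu
    subst hb
    obtain ⟨q, hq, hm⟩ := (branch_eq_iff_mem_support hT h.symm).1 hu
    rw [(hT.existsUnique_path _ w).unique hq hp] at hm
    exact h.ne ((branch_self hT u).symm.trans (hpu u hm))
  · intro hne
    obtain ⟨q, hq, -⟩ := hT.existsUnique_path v w
    have hu : u ∉ q.support := fun hm => hne ((branch_eq_iff_mem_support hT h.symm).2 ⟨q, hq, hm⟩)
    rw [branch_eq_snd hT (p := .cons h q) (hq.cons hu), SimpleGraph.Walk.snd_cons]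

end Branch

section Sizes

variable {V : Type*} [Fintype V] {T : SimpleGraph V}

theorem subtreeSize_eq_card [DecidableEq V] (hT : T.IsTree) {u c : V} (hc : T.Adj u c) :
    subtreeSize T u c = (Finset.univ.filter fun w => branch T u w = c).card := by
  rw [subtreeSize, ← Set.ncard_coe_finset]
  congr 1
  ext w
  simp [branch_eq_iff_mem_support hT hc]

theorem subtreeSize_add_subtreeSize (hT : T.IsTree) {u v : V} (h : T.Adj u v) :
    subtreeSize T u v + subtreeSize T v u = Fintype.card V := by
  classical
  rw [subtreeSize_eq_card hT h, subtreeSize_eq_card hT h.symm, ← Finset.card_univ,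
    ← Finset.card_filter_add_card_filter_not (s := Finset.univ) (fun w => branch T u w = v)]
  simp only [branch_eq_iff_branch_ne hT h, not_not]

theorem one_add_sum_subtreeSize (hT : T.IsTree) (u : V) [Fintype (T.neighborSet u)] :
    1 + ∑ c ∈ T.neighborFinset u, subtreeSize T u c = Fintype.card V := by
  classical
  have hmaps : ∀ w ∈ Finset.univ.erase u, branch T u w ∈ T.neighborFinset u := fun w hw => by
    simpa using adj_branch hT (Finset.ne_of_mem_erase hw)
  rw [← Finset.card_univ, ← Finset.card_erase_add_one (Finset.mem_univ u), add_comm,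
    Finset.card_eq_sum_card_fiberwise hmaps]
  congr 1
  refine Finset.sum_congr rfl fun c hc => ?_
  rw [SimpleGraph.mem_neighborFinset] at hc
  rw [subtreeSize_eq_card hT hc]
  congr 1
  ext w
  have : branch T u w = c → w ≠ u := by
    rintro h rfl
    exact hc.ne ((branch_self hT w).symm.trans h)
  simpa using this

end Sizes

/-! ### Noncrossing orders of the vertices -/

section Noncrossing

variable {V : Type*} {T : SimpleGraph V} {α : Type*} [LinearOrder α] {f : V → α}

/-- No two edges of `T` cross in the order of the vertices given by `f`. -/
def Noncrossing (T : SimpleGraph V) (f : V → α) : Prop :=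
  ∀ s t p q, T.Adj s t → T.Adj p q → ¬ (f s < f p ∧ f p < f t ∧ f t < f q)

/-- `x` is strictly between `p` and `q` in the order given by `f`. -/
def Between (f : V → α) (p q x : V) : Prop :=
  (f p < f x ∧ f x < f q) ∨ (f q < f x ∧ f x < f p)

theorem between_comm {p q x : V} : Between f p q x ↔ Between f q p x := Or.comm

theorem Noncrossing.between_iff_of_adj (hf : Noncrossing T f) (hinj : Function.Injective f)
    {p q x y : V} (hpq : T.Adj p q) (hxy : T.Adj x y) (hxp : x ≠ p) (hxq : x ≠ q) (hyp : y ≠ p)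
    (hyq : y ≠ q) : Between f p q x ↔ Between f p q y := by
  have h1 := hf p q x y hpq hxy
  have h2 := hf q p x y hpq.symm hxy
  have h3 := hf p q y x hpq hxy.symm
  have h4 := hf q p y x hpq.symm hxy.symm
  have h5 := hf x y p q hxy hpq
  have h6 := hf x y q p hxy hpq.symm
  have h7 := hf y x p q hxy.symm hpq
  have h8 := hf y x q p hxy.symm hpq.symm
  have := hinj.ne hxp
  have := hinj.ne hxq
  have := hinj.ne hyp
  have := hinj.ne hyq
  unfold Between
  grind

theorem Noncrossing.between_iff_of_walk (hf : Noncrossing T f) (hinj : Function.Injective f)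
    {p q a b : V} (hpq : T.Adj p q) (w : T.Walk a b) (hp : p ∉ w.support) (hq : q ∉ w.support) :
    Between f p q a ↔ Between f p q b := by
  induction w with
  | nil => rfl
  | cons h w ih =>
    rw [SimpleGraph.Walk.support_cons, List.mem_cons, not_or] at hp hq
    rw [← ih hp.2 hq.2]
    exact hf.between_iff_of_adj hinj hpq h (Ne.symm hp.1) (Ne.symm hq.1)
      (fun e => hp.2 (e ▸ w.start_mem_support)) (fun e => hq.2 (e ▸ w.start_mem_support))

theorem Noncrossing.between_iff_of_disjoint (hf : Noncrossing T f) (hinj : Function.Injective f)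
    {s t a b : V} (w : T.Walk s t) (w' : T.Walk a b) (hw : w.support.Disjoint w'.support) :
    Between f s t a ↔ Between f s t b := by
  induction w' with
  | nil => rfl
  | @cons a c b h w' ih =>
    rw [SimpleGraph.Walk.support_cons, List.disjoint_cons_right] at hw
    rw [← ih hw.2]
    have hc : c ∉ w.support := List.disjoint_right.1 hw.2 w'.start_mem_support
    have key := hf.between_iff_of_walk hinj h w hw.1 hc
    have := hinj.ne (ne_of_mem_of_not_mem w.start_mem_support hw.1)
    have := hinj.ne (ne_of_mem_of_not_mem w.end_mem_support hw.1)
    have := hinj.ne (ne_of_mem_of_not_mem w.start_mem_support hc)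
    have := hinj.ne (ne_of_mem_of_not_mem w.end_mem_support hc)
    have := hinj.ne h.ne
    unfold Between at *
    grind

theorem Noncrossing.branch_eq_of_lt_of_lt (hT : T.IsTree) (hf : Noncrossing T f)
    (hinj : Function.Injective f) {u : V} (hu : ∀ x, f u ≤ f x) {x y z : V}
    (hxz : branch T u x = branch T u z) (hxy : f x < f y) (hyz : f y < f z) :
    branch T u y = branch T u x := by
  by_contra hne
  have hyu : y ≠ u := fun h => (hu x).not_gt (h ▸ hxy)
  have hzu : z ≠ u := fun h => (hu y).not_gt (h ▸ hyz)
  have hxu : x ≠ u := fun h =>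
    hzu ((branch_eq_self_iff hT).1 (hxz.symm.trans ((branch_eq_self_iff hT).2 h)))
  obtain ⟨p, -, hp⟩ := exists_isPath_forall_branch_eq hT hyu
  obtain ⟨q, -, hq⟩ := exists_isPath_forall_branch_eq hT hxu
  obtain ⟨r, -, hr⟩ := exists_isPath_forall_branch_eq hT hzu
  have hdisj : (SimpleGraph.Walk.cons (adj_branch hT hyu) p).support.Disjoint
      (q.reverse.append (r.copy hxz.symm rfl)).support := by
    intro w hw hw'
    have hwx : branch T u w = branch T u x := by
      simp only [SimpleGraph.Walk.mem_support_append_iff, SimpleGraph.Walk.support_reverse,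
        List.mem_reverse, SimpleGraph.Walk.support_copy] at hw'
      exact hw'.elim (hq w) fun h => (hr w h).trans hxz.symm
    rcases List.mem_cons.1 hw with rfl | hw
    · exact hxu ((branch_eq_self_iff hT).1 (hwx.symm.trans (branch_self hT w)))
    · exact hne ((hp w hw).symm.trans hwx)
  have key := hf.between_iff_of_disjoint hinj _ _ hdisj
  have := (hu x).lt_of_ne (hinj.ne hxu.symm)
  unfold Between at key
  grind

theorem Noncrossing.lt_of_branch_eq (hT : T.IsTree) (hf : Noncrossing T f)
    (hinj : Function.Injective f) {u : V} (hu : ∀ x, f u ≤ f x) {x x' y y' : V}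
    (hx : branch T u x = branch T u x') (hy : branch T u y = branch T u y')
    (hne : branch T u x ≠ branch T u y) (h : f x < f y) : f x' < f y' := by
  by_contra! hle
  have hlt : f y' < f x' := hle.lt_of_ne (hinj.ne fun e => hne (by rw [hx, hy, e]))
  rcases lt_or_gt_of_ne (hinj.ne fun e => hne (by rw [hy, e]) : f x ≠ f y') with h' | h'
  · exact hne ((hf.branch_eq_of_lt_of_lt hT hinj hu hx h' hlt).symm.trans hy.symm)
  · exact hne ((hf.branch_eq_of_lt_of_lt hT hinj hu hy.symm h' h).trans hy.symm)

theorem Noncrossing.of_forall_branch (hT : T.IsTree) (hf : Noncrossing T f)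
    (hinj : Function.Injective f) {β : Type*} [LinearOrder β] {g : V → β} {u : V}
    (huf : ∀ x, f u ≤ f x) (hug : ∀ x, g u ≤ g x)
    (hconv : ∀ x y z, branch T u x = branch T u z → g x < g y → g y < g z →
      branch T u y = branch T u x)
    (hord : ∀ c, (∀ x y, branch T u x = c → branch T u y = c → (g x < g y ↔ f x < f y)) ∨
      (∀ x y, branch T u x = c → branch T u y = c → (g x < g y ↔ f y < f x))) :
    Noncrossing T g := by
  rintro s t p q hst hpq ⟨hsp, hpt, htq⟩
  have ht : t ≠ u := fun e => (hug p).not_gt (e ▸ hpt)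
  have hp : p ≠ u := fun e => (hug s).not_gt (e ▸ hsp)
  have hq : q ≠ u := fun e => (hug t).not_gt (e ▸ htq)
  have hbq : branch T u q = branch T u p := (branch_eq_of_adj hT hp hq hpq).symm
  have hbt : branch T u t = branch T u p := hconv p t q hbq.symm hpt htq
  have hup : f u < f p := (huf p).lt_of_ne (hinj.ne hp.symm)
  have huq : f u < f q := (huf q).lt_of_ne (hinj.ne hq.symm)
  have hbs : s ≠ u → branch T u s = branch T u p := fun hs =>
    (branch_eq_of_adj hT hs ht hst).trans hbt
  have h₁ := hf s t p q hst hpq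
  have h₂ := hf s t q p hst hpq.symm
  have h₃ := hf q p t s hpq.symm hst.symm
  rcases hord (branch T u p) with h | h <;>
  · rw [h p t rfl hbt] at hpt
    rw [h t q hbt hbq] at htq
    by_cases hs : s = u
    · grind
    · rw [h s p (hbs hs) rfl] at hsp
      grind

end Noncrossing

section DepthFirst

variable {α : Type*} [LinearOrder α]

theorem append_singleton_lt_append_singleton {a b : List α} {t : α} (hab : a < b)
    (hbt : b < a ++ [t]) (q : α) : b ++ [q] < a ++ [t] := by
  induction a generalizing b with
  | nil =>
    cases b with
    | nil => exact absurd hab (lt_irrefl _)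
    | cons x l =>
      rcases List.cons_lt_cons_iff.1 hbt with h | ⟨-, h⟩
      · exact List.cons_lt_cons_iff.2 (.inl h)
      · exact absurd h (List.not_lt_nil l)
  | cons x a ih =>
    cases b with
    | nil => exact absurd hab (List.not_lt_nil _)
    | cons y b =>
      simp only [List.cons_append, List.cons_lt_cons_iff] at hab hbt ⊢
      grind

variable {V : Type*} {T : SimpleGraph V}

theorem support_eq_append_or (hT : T.IsTree) {r x y : V} {p : T.Walk r x}
    {q : T.Walk r y} (hp : p.IsPath) (hq : q.IsPath) (h : T.Adj x y) :
    q.support = p.support ++ [y] ∨ p.support = q.support ++ [x] := by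
  by_cases hx : x ∈ q.support
  · left
    rw [hT.2.path_concat hp hq h hx, SimpleGraph.Walk.support_concat]
  · right
    rw [hT.2.path_concat hq hp h.symm
      (hT.2.mem_support_of_ne_mem_support_of_adj_of_isPath hp hq h hx),
      SimpleGraph.Walk.support_concat]

/-- The depth-first traversals of a tree are noncrossing: they order the vertices
lexicographically by their paths from the root. -/
theorem exists_noncrossing_list [LinearOrder V] (hT : T.IsTree) :
    ∃ f : V → List V, Function.Injective f ∧ Noncrossing T f := by
  obtain ⟨r⟩ := hT.1.nonempty
  choose p hp using fun w => (hT.existsUnique_path r w).exists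
  have hlast (w : V) : (p w).support.getLast (p w).support_ne_nil = w := (p w).getLast_support
  refine ⟨fun w => (p w).support, fun x y h => ?_, ?_⟩
  · rw [← hlast x, ← hlast y]
    simp only [h]
  · rintro s t a b hst hab ⟨hsa, hat, htb⟩
    have hlt_append (l : List V) (x : V) : l < l ++ [x] := by
      simpa using List.append_left_lt (l₁ := l) (List.nil_lt_cons x [])
    have ht : (p t).support = (p s).support ++ [t] :=
      (support_eq_append_or hT (hp s) (hp t) hst).resolve_right fun h =>
        lt_asymm (hsa.trans hat) (by simpa only [h] using hlt_append _ _)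
    have hb : (p b).support = (p a).support ++ [b] :=
      (support_eq_append_or hT (hp a) (hp b) hab).resolve_right fun h =>
        lt_asymm (hat.trans htb) (by simpa only [h] using hlt_append _ _)
    simp only [ht, hb] at hat htb
    exact lt_asymm htb (append_singleton_lt_append_singleton hsa hat b)

end DepthFirst

/-! ### Arrangements and their rotations -/

section Arrangement

variable {V : Type*} [Fintype V]

/-- The position of a vertex, as a natural number. -/
def pos (π : Arrangement V) (v : V) : ℕ := π v

theorem pos_injective (π : Arrangement V) : Function.Injective (pos π) :=
  fun _ _ h => π.injective (Fin.ext h)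

theorem pos_lt_card (π : Arrangement V) (v : V) : pos π v < Fintype.card V := (π v).2

theorem mem_planarArrangements [DecidableEq V] {T : SimpleGraph V} [DecidableRel T.Adj]
    {π : Arrangement V} : π ∈ planarArrangements T ↔ Noncrossing T (pos π) := by
  simp only [planarArrangements, numCrossings, Finset.mem_filter, Finset.mem_univ, true_and,
    Finset.card_eq_zero, Finset.filter_eq_empty_iff, Prod.forall, Noncrossing, pos,
    Fin.lt_def, not_and, forall_const]

theorem exists_arrangement_of_injective {α : Type*} [LinearOrder α] {f : V → α}
    (hf : Function.Injective f) :
    ∃ π : Arrangement V, ∀ x y, pos π x < pos π y ↔ f x < f y := by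
  let : LinearOrder V := LinearOrder.lift' f hf
  let e : Fin (Fintype.card V) ≃o V := monoEquivOfFin V rfl
  exact ⟨e.symm.toEquiv, fun x y => e.symm.lt_iff_lt⟩

theorem arrangement_ext {π ρ : Arrangement V}
    (h : ∀ x y, pos π x < pos π y ↔ pos ρ x < pos ρ y) : π = ρ := by
  have hmono : StrictMono fun i => ρ (π.symm i) := fun i j hij =>
    (h (π.symm i) (π.symm j)).1 (by simpa [pos] using hij)
  let e : Fin (Fintype.card V) ≃o Fin (Fintype.card V) :=
    hmono.orderIsoOfSurjective _ (ρ.surjective.comp π.symm.surjective)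
  ext v
  have := congrArg (fun e => e (π v)) (Subsingleton.elim e (OrderIso.refl _))
  simpa [e] using congrArg Fin.val this.symm

theorem pos_eq_zero_iff (π : Arrangement V) {u : V} : pos π u = 0 ↔ ∀ x, pos π u ≤ pos π x := by
  refine ⟨fun h x => h ▸ Nat.zero_le _, fun h => ?_⟩
  have : Nonempty V := ⟨u⟩
  simpa [pos] using h (π.symm ⟨0, Fintype.card_pos⟩)

theorem planarArrangements_nonempty [DecidableEq V] {T : SimpleGraph V} [DecidableRel T.Adj]
    (hT : T.IsTree) : (planarArrangements T).Nonempty := by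
  let : LinearOrder V := LinearOrder.lift' (Fintype.equivFin V) (Fintype.equivFin V).injective
  obtain ⟨f, hinj, hf⟩ := exists_noncrossing_list hT
  obtain ⟨π, hπ⟩ := exists_arrangement_of_injective hinj
  refine ⟨π, mem_planarArrangements.2 fun s t p q hst hpq => ?_⟩
  simpa only [hπ] using hf s t p q hst hpq

/-- The arrangement after a cyclic shift of the positions. -/
def rotate [Nonempty V] (r : Fin (Fintype.card V)) (π : Arrangement V) : Arrangement V :=
  π.trans (Equiv.addRight r)

variable [Nonempty V]

theorem rotate_apply (r : Fin (Fintype.card V)) (π : Arrangement V) (v : V) :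
    rotate r π v = π v + r := rfl

theorem rotate_neg_rotate (r : Fin (Fintype.card V)) (π : Arrangement V) :
    rotate (-r) (rotate r π) = π := by
  ext v
  simp [rotate_apply]

theorem pos_rotate (r : Fin (Fintype.card V)) (π : Arrangement V) (v : V) :
    pos (rotate r π) v = if pos π v + r < Fintype.card V then pos π v + r
      else pos π v + r - Fintype.card V := by
  have h : pos (rotate r π) v = (pos π v + r) % Fintype.card V := Fin.val_add _ _
  have h1 := pos_lt_card π v
  have h2 := r.2
  rw [h]
  split_ifs with hlt
  · exact Nat.mod_eq_of_lt hlt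
  · rw [Nat.mod_eq_sub_mod (by omega), Nat.mod_eq_of_lt (by omega)]

theorem Noncrossing.rotate {T : SimpleGraph V} {π : Arrangement V} (hπ : Noncrossing T (pos π))
    (r : Fin (Fintype.card V)) : Noncrossing T (pos (rotate r π)) := by
  intro s t p q hst hpq
  have := hπ s t p q hst hpq
  have := hπ p q t s hpq hst.symm
  have := hπ t s q p hst.symm hpq.symm
  have := hπ q p s t hpq.symm hst
  have := pos_lt_card π
  grind [pos_rotate]

theorem rotate_mem_planarArrangements [DecidableEq V] {T : SimpleGraph V} [DecidableRel T.Adj]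
    (r : Fin (Fintype.card V)) {π : Arrangement V} (h : π ∈ planarArrangements T) :
    PlanarLin.rotate r π ∈ planarArrangements T :=
  mem_planarArrangements.2 ((mem_planarArrangements.1 h).rotate r)

theorem sum_planarArrangements_rotate [DecidableEq V] {T : SimpleGraph V} [DecidableRel T.Adj]
    {M : Type*} [AddCommMonoid M] (F : Arrangement V → M) (r : Fin (Fintype.card V)) :
    ∑ π ∈ planarArrangements T, F (rotate r π) = ∑ π ∈ planarArrangements T, F π := by
  refine Finset.sum_nbij' (rotate r) (rotate (-r)) (fun _ => rotate_mem_planarArrangements r)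
    (fun _ => rotate_mem_planarArrangements (-r)) (fun π _ => rotate_neg_rotate r π)
    (fun π _ => ?_) fun _ _ => rfl
  simpa using rotate_neg_rotate (-r) π

end Arrangement

/-! ### Separation probabilities -/

section Reorder

variable {V : Type*} [Fintype V] [DecidableEq V] {T : SimpleGraph V}

/-- The sort key for permuting the branches at `u` by `σ` and reversing those in `e`. -/
noncomputable def reorderKey (T : SimpleGraph V) (u : V) (σ : Equiv.Perm V) (e : Finset V)
    (π : Arrangement V) (w : V) : ℕ ×ₗ ℤ :=
  toLex (pos π (σ (branch T u w)), if branch T u w ∈ e then -(pos π w : ℤ) else pos π w)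

theorem reorderKey_injective (u : V) (σ : Equiv.Perm V) (e : Finset V) (π : Arrangement V) :
    Function.Injective (reorderKey T u σ e π) := by
  intro x y h
  obtain ⟨h₁, h₂⟩ := Prod.ext_iff.1 (toLex.injective h)
  have hb : branch T u x = branch T u y := σ.injective (pos_injective π h₁)
  refine pos_injective π ?_
  simp only [hb] at h₂
  split_ifs at h₂ <;> omega

/-- The arrangement in which the branches at `u` are permuted by `σ` and those whose neighbour of
`u` is in `e` are reversed. -/
noncomputable def reorder (T : SimpleGraph V) (u : V) (σ : Equiv.Perm V) (e : Finset V)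
    (π : Arrangement V) : Arrangement V :=
  (exists_arrangement_of_injective (reorderKey_injective (T := T) u σ e π)).choose

theorem pos_reorder_lt_iff (u : V) (σ : Equiv.Perm V) (e : Finset V) (π : Arrangement V)
    (x y : V) : pos (reorder T u σ e π) x < pos (reorder T u σ e π) y ↔
      if branch T u x = branch T u y then
        if branch T u x ∈ e then pos π y < pos π x else pos π x < pos π y
      else pos π (σ (branch T u x)) < pos π (σ (branch T u y)) := by
  rw [reorder, (exists_arrangement_of_injective (reorderKey_injective u σ e π)).choose_spec,
    reorderKey, reorderKey, Prod.Lex.toLex_lt_toLex]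
  by_cases h : branch T u x = branch T u y
  · by_cases h' : branch T u y ∈ e <;> simp [h, h']
  · simp [h, (pos_injective π).ne (σ.injective.ne h)]

/-- The planar arrangements with `u` in the first position. -/
def planarAt (T : SimpleGraph V) [DecidableRel T.Adj] (u : V) : Finset (Arrangement V) :=
  (planarArrangements T).filter fun π => ∀ x, pos π u ≤ pos π x

variable [DecidableRel T.Adj]

theorem mem_planarAt {u : V} {π : Arrangement V} :
    π ∈ planarAt T u ↔ Noncrossing T (pos π) ∧ ∀ x, pos π u ≤ pos π x := by
  rw [planarAt, Finset.mem_filter, mem_planarArrangements]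

theorem pos_branch_lt_iff (hT : T.IsTree) {u x y : V} {π : Arrangement V} (hπ : π ∈ planarAt T u)
    (hne : branch T u x ≠ branch T u y) :
    pos π (branch T u x) < pos π (branch T u y) ↔ pos π x < pos π y := by
  obtain ⟨hf, hu⟩ := mem_planarAt.1 hπ
  have hb := branch_branch hT u
  exact ⟨hf.lt_of_branch_eq hT (pos_injective π) hu (hb x) (hb y) (by rwa [hb, hb]),
    hf.lt_of_branch_eq hT (pos_injective π) hu (hb x).symm (hb y).symm hne⟩

theorem reorder_mem_planarAt (hT : T.IsTree) {u : V} {σ : Equiv.Perm V} (hσ : σ u = u)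
    (e : Finset V) {π : Arrangement V} (hπ : π ∈ planarAt T u) :
    reorder T u σ e π ∈ planarAt T u := by
  obtain ⟨hf, hu⟩ := mem_planarAt.1 hπ
  have hu' (x : V) : pos (reorder T u σ e π) u ≤ pos (reorder T u σ e π) x := by
    have := hu x
    have := hu (σ (branch T u x))
    rw [← not_lt, pos_reorder_lt_iff, branch_self hT, hσ]
    split_ifs with hx <;> simp_all [branch_eq_self_iff hT]
  refine mem_planarAt.2 ⟨hf.of_forall_branch hT (pos_injective π) hu hu' ?_ fun c => ?_, hu'⟩
  · intro x y z hxz hxy hyz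
    by_contra hne
    rw [pos_reorder_lt_iff, if_neg (Ne.symm hne)] at hxy
    rw [pos_reorder_lt_iff, if_neg (hxz ▸ hne), ← hxz] at hyz
    exact lt_asymm hxy hyz
  · by_cases hc : c ∈ e
    · right
      intro x y hx hy
      rw [pos_reorder_lt_iff, if_pos (hx.trans hy.symm), if_pos (hx ▸ hc)]
    · left
      intro x y hx hy
      rw [pos_reorder_lt_iff, if_pos (hx.trans hy.symm), if_neg (hx ▸ hc)]

theorem reorder_reorder (hT : T.IsTree) {u : V} {σ : Equiv.Perm V} (hσ : ∀ c, σ (σ c) = c)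
    (hbσ : ∀ w, branch T u (σ (branch T u w)) = σ (branch T u w)) (e : Finset V)
    {π : Arrangement V} (hπ : π ∈ planarAt T u) :
    reorder T u σ e (reorder T u σ e π) = π := by
  refine arrangement_ext fun x y => ?_
  by_cases h : branch T u x = branch T u y
  · by_cases h' : branch T u y ∈ e <;> simp [pos_reorder_lt_iff, h, h']
  · simpa [pos_reorder_lt_iff, hbσ, hσ, h] using pos_branch_lt_iff hT hπ h

theorem card_filter_reorder (hT : T.IsTree) {u : V} {σ : Equiv.Perm V} (hu : σ u = u)
    (hσ : ∀ c, σ (σ c) = c) (hbσ : ∀ w, branch T u (σ (branch T u w)) = σ (branch T u w))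
    (e : Finset V) {X Y : Arrangement V → Prop} [DecidablePred X] [DecidablePred Y]
    (h : ∀ π ∈ planarAt T u, Y (reorder T u σ e π) ↔ X π) :
    ((planarAt T u).filter X).card = ((planarAt T u).filter Y).card := by
  have hrr := fun π => reorder_reorder (π := π) hT hσ hbσ e
  refine Finset.card_nbij' (reorder T u σ e) (reorder T u σ e) ?_ ?_
    (fun π hπ => hrr π (Finset.mem_filter.1 hπ).1) fun π hπ => hrr π (Finset.mem_filter.1 hπ).1
  · intro π hπ
    obtain ⟨hπ, hX⟩ := Finset.mem_filter.1 hπ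
    exact Finset.mem_filter.2 ⟨reorder_mem_planarAt hT hu e hπ, (h π hπ).2 hX⟩
  · intro π hπ
    obtain ⟨hπ, hY⟩ := Finset.mem_filter.1 hπ
    have hmem := reorder_mem_planarAt hT hu e hπ
    exact Finset.mem_filter.2 ⟨hmem, (h _ hmem).1 ((hrr π hπ).symm ▸ hY)⟩

end Reorder

section Separates

variable {V : Type*}

instance decidableBetween {α : Type*} [LinearOrder α] (f : V → α) (p q x : V) :
    Decidable (Between f p q x) :=
  inferInstanceAs (Decidable (_ ∨ _))

/-- The pair `p`, `q` separates `x` from `y` on the circle of positions: exactly one of `x` and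
`y` is between `p` and `q` in the order given by `f`. -/
def Separates {α : Type*} [LinearOrder α] (f : V → α) (p q x y : V) : Prop :=
  ¬ (Between f p q x ↔ Between f p q y)

instance decidableSeparates {α : Type*} [LinearOrder α] (f : V → α) (p q x y : V) :
    Decidable (Separates f p q x y) :=
  inferInstanceAs (Decidable (¬ _))

theorem separates_comm_left {α : Type*} [LinearOrder α] {f : V → α} {p q x y : V} :
    Separates f p q x y ↔ Separates f q p x y := by
  simp only [Separates, between_comm (p := p)]

theorem separates_comm_right {α : Type*} [LinearOrder α] {f : V → α} {p q x y : V} :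
    Separates f p q x y ↔ Separates f p q y x :=
  not_congr iff_comm

variable [Fintype V]

theorem separates_rotate_iff [Nonempty V] (r : Fin (Fintype.card V)) (π : Arrangement V)
    {p q x y : V} (hxp : x ≠ p) (hxq : x ≠ q) (hyp : y ≠ p) (hyq : y ≠ q) :
    Separates (pos (rotate r π)) p q x y ↔ Separates (pos π) p q x y := by
  have := (pos_injective π).ne hxp
  have := (pos_injective π).ne hxq
  have := (pos_injective π).ne hyp
  have := (pos_injective π).ne hyq
  have hlt := pos_lt_card π
  have := hlt p
  have := hlt q
  have := hlt x
  have := hlt y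
  have := r.2
  simp only [Separates, Between, pos_rotate]
  split_ifs <;> omega

variable [DecidableEq V] {T : SimpleGraph V} [DecidableRel T.Adj]

theorem card_filter_planarArrangements [Nonempty V] (u : V) {X : Arrangement V → Prop}
    [DecidablePred X] (hX : ∀ r π, X (rotate r π) ↔ X π) :
    ((planarArrangements T).filter X).card =
      Fintype.card V * ((planarAt T u).filter X).card := by
  rw [Finset.card_eq_sum_card_fiberwise (f := fun π : Arrangement V => π u) (t := Finset.univ)
    (fun _ _ => Finset.mem_coe.2 (Finset.mem_univ _)),
    Finset.sum_const_nat (m := ((planarAt T u).filter X).card), Finset.card_univ, Fintype.card_fin]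
  intro r _
  have hmem (π : Arrangement V) : π ∈ (planarAt T u).filter X ↔
      π ∈ planarArrangements T ∧ π u = 0 ∧ X π := by
    rw [Finset.mem_filter, planarAt, Finset.mem_filter, ← pos_eq_zero_iff, pos, and_assoc,
      Fin.val_eq_zero_iff]
  refine Finset.card_nbij' (rotate (-r)) (rotate r) (fun π hπ => ?_) (fun π hπ => ?_)
    (fun π _ => ?_) fun π _ => ?_
  · obtain ⟨⟨hπ, hX'⟩, hr⟩ := by simpa only [Finset.mem_coe, Finset.mem_filter] using hπ
    refine (hmem _).2 ⟨rotate_mem_planarArrangements _ hπ, ?_, (hX _ _).2 hX'⟩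
    rw [rotate_apply, hr, add_neg_cancel]
  · obtain ⟨hπ, hu, hX'⟩ := (hmem π).1 hπ
    simp only [Finset.mem_coe, Finset.mem_filter]
    refine ⟨⟨rotate_mem_planarArrangements _ hπ, (hX _ _).2 hX'⟩, ?_⟩
    rw [rotate_apply, hu, zero_add]
  · simpa using rotate_neg_rotate (-r) π
  · exact rotate_neg_rotate r π

theorem card_planarArrangements [Nonempty V] (u : V) :
    (planarArrangements T).card = Fintype.card V * (planarAt T u).card := by
  simpa using card_filter_planarArrangements (T := T) u (X := fun _ => True) fun _ _ => Iff.rfl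

theorem not_separates_of_branch_eq (hT : T.IsTree) {u v x y : V} {π : Arrangement V}
    (hπ : π ∈ planarArrangements T) (huv : T.Adj u v) (hx : x ≠ u) (hy : y ≠ u)
    (hxy : branch T u x = branch T u y) (hxv : branch T u x ≠ v) :
    ¬ Separates (pos π) u v x y := by
  have hf := mem_planarArrangements.1 hπ
  have hb {z : V} (hz : z ≠ u) (hzx : branch T u z = branch T u x) :
      Between (pos π) u v (branch T u z) ↔ Between (pos π) u v z := by
    obtain ⟨p, -, hp⟩ := exists_isPath_forall_branch_eq hT hz
    refine hf.between_iff_of_walk (pos_injective π) huv p (fun h => ?_) fun h => ?_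
    · exact hz ((branch_eq_self_iff hT).1 ((hp u h).symm.trans (branch_self hT u)))
    · exact hxv (hzx.symm.trans ((hp v h).symm.trans (branch_of_adj hT huv)))
  rw [Separates, not_not, ← hb hx rfl, ← hb hy hxy.symm, hxy]

theorem card_filter_between_comm (hT : T.IsTree) {u x y z : V} (hx : x ≠ u) (hz : z ≠ u)
    (hxy : branch T u x ≠ branch T u y) (hxz : branch T u x ≠ branch T u z)
    (hyz : branch T u y ≠ branch T u z) :
    ((planarAt T u).filter fun π => Between (pos π) x y z).card =
      ((planarAt T u).filter fun π => Between (pos π) z y x).card := by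
  have hax := adj_branch hT hx
  have haz := adj_branch hT hz
  refine card_filter_reorder hT (σ := Equiv.swap (branch T u x) (branch T u z))
    (Equiv.swap_apply_of_ne_of_ne hax.ne haz.ne) (Equiv.swap_apply_self _ _) (fun w => ?_) ∅
    fun π hπ => ?_
  · rw [Equiv.swap_apply_def]
    split_ifs
    exacts [branch_of_adj hT haz, branch_of_adj hT hax, branch_branch hT u w]
  · simp [Between, pos_reorder_lt_iff, hxy, hxy.symm, hxz, hxz.symm, hyz, hyz.symm,
      pos_branch_lt_iff hT hπ, Equiv.swap_apply_of_ne_of_ne hxy.symm hyz]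

theorem three_mul_card_between (hT : T.IsTree) {u x y z : V} (hx : x ≠ u) (hy : y ≠ u)
    (hz : z ≠ u) (hxy : branch T u x ≠ branch T u y) (hxz : branch T u x ≠ branch T u z)
    (hyz : branch T u y ≠ branch T u z) :
    3 * ((planarAt T u).filter fun π => Between (pos π) x y z).card = (planarAt T u).card := by
  have hzyx := card_filter_between_comm hT hx hz hxy hxz hyz
  have hxzy := card_filter_between_comm hT hy hz hxy.symm hyz hxz
  simp only [between_comm (p := y) (q := x)] at hxzy
  have hsum : ((planarAt T u).filter fun π => Between (pos π) x y z).card +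
      ((planarAt T u).filter fun π => Between (pos π) z y x).card +
      ((planarAt T u).filter fun π => Between (pos π) z x y).card = (planarAt T u).card := by
    rw [Finset.card_filter, Finset.card_filter, Finset.card_filter, ← Finset.sum_add_distrib,
      ← Finset.sum_add_distrib, Finset.card_eq_sum_ones]
    refine Finset.sum_congr rfl fun π _ => ?_
    have := (pos_injective π).ne (ne_of_apply_ne _ hxy)
    have := (pos_injective π).ne (ne_of_apply_ne _ hxz)
    have := (pos_injective π).ne (ne_of_apply_ne _ hyz)
    simp only [Between]
    grind
  omega

theorem three_mul_card_separates (hT : T.IsTree) {u v x y : V} (huv : T.Adj u v) (hx : x ≠ u)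
    (hy : y ≠ u) (hxy : branch T u x ≠ branch T u y) (hxv : branch T u x ≠ v)
    (hyv : branch T u y ≠ v) :
    3 * ((planarArrangements T).filter fun π => Separates (pos π) u v x y).card =
      (planarArrangements T).card := by
  have : Nonempty V := ⟨u⟩
  have hv : branch T u v = v := branch_of_adj hT huv
  have hxv' : x ≠ v := ne_of_apply_ne (branch T u) (hv.symm ▸ hxv)
  have hyv' : y ≠ v := ne_of_apply_ne (branch T u) (hv.symm ▸ hyv)
  rw [card_filter_planarArrangements u fun r π => separates_rotate_iff r π hx hxv' hy hyv',
    card_planarArrangements u, ← three_mul_card_between hT hx hy huv.ne' hxy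
      (by rwa [hv]) (by rwa [hv]), mul_left_comm]
  congr 3
  refine Finset.filter_congr fun π hπ => ?_
  have := (mem_planarAt.1 hπ).2
  have := (pos_injective π).ne hx
  have := (pos_injective π).ne hy
  have := (pos_injective π).ne hxv'
  have := (pos_injective π).ne hyv'
  simp only [Separates, Between]
  grind

theorem two_mul_card_separates (hT : T.IsTree) {u v x y : V} (huv : T.Adj u v) (hx : x ≠ u)
    (hy : y ≠ v) (hxv : branch T u x ≠ v) (hyv : branch T u y = v) :
    2 * ((planarArrangements T).filter fun π => Separates (pos π) u v x y).card =
      (planarArrangements T).card := by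
  have : Nonempty V := ⟨u⟩
  have hv : branch T u v = v := branch_of_adj hT huv
  have hxv' : x ≠ v := ne_of_apply_ne (branch T u) (hv.symm ▸ hxv)
  have hyu : y ≠ u := fun h => huv.ne (((branch_eq_self_iff hT).2 h).symm.trans hyv)
  have hflip : ((planarAt T u).filter fun π => Separates (pos π) u v x y).card =
      ((planarAt T u).filter fun π => ¬ Separates (pos π) u v x y).card := by
    refine card_filter_reorder hT (σ := 1) rfl (fun _ => rfl) (branch_branch hT u) {v}
      fun π hπ => ?_
    · have hρ := reorder_mem_planarAt hT (σ := 1) rfl {v} hπ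
      have hxlt : pos (reorder T u 1 {v} π) x < pos (reorder T u 1 {v} π) v ↔
          pos π x < pos π v := by
        rw [pos_reorder_lt_iff, hv, if_neg hxv]
        simpa only [Equiv.Perm.one_apply, hv] using
          pos_branch_lt_iff hT hπ (x := x) (y := v) (by rwa [hv])
      have hylt : pos (reorder T u 1 {v} π) y < pos (reorder T u 1 {v} π) v ↔
          pos π v < pos π y := by
        rw [pos_reorder_lt_iff, hv, if_pos hyv, hyv, if_pos (Finset.mem_singleton_self v)]
      have := (mem_planarAt.1 hπ).2
      have := (mem_planarAt.1 hρ).2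
      have := (pos_injective π).ne hx
      have := (pos_injective π).ne hy
      have := (pos_injective π).ne hxv'
      have := (pos_injective π).ne hyu
      have := (pos_injective (reorder T u 1 {v} π)).ne hx
      have := (pos_injective (reorder T u 1 {v} π)).ne hyu
      simp only [Separates, Between]
      grind
  rw [card_filter_planarArrangements u fun r π => separates_rotate_iff r π hx hxv' hyu hy,
    card_planarArrangements u,
    ← Finset.card_filter_add_card_filter_not (s := planarAt T u)
      (fun π => Separates (pos π) u v x y), ← hflip, mul_left_comm, two_mul]

end Separates

/-! ### The expected length of an edge -/

section Length

variable {V : Type*} [Fintype V]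

theorem edgeLength_of_pos_add_eq {π : Arrangement V} {u v : V} {d : ℕ}
    (h : pos π u + d = pos π v) : edgeLength π s(u, v) = d := by
  change |(pos π u : ℚ) - pos π v| = d
  rw [← h, Nat.cast_add, sub_add_cancel_left, abs_neg, Nat.abs_cast]

theorem edgeLength_rotate [Nonempty V] {π : Arrangement V} {u v : V} {d : ℕ}
    (h : pos π u + d = pos π v) (r : Fin (Fintype.card V)) : edgeLength (rotate r π) s(u, v) =
      d + if r.val ∈ Finset.Ico (Fintype.card V - pos π v) (Fintype.card V - pos π u)
        then (Fintype.card V : ℚ) - 2 * d else 0 := by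
  have hu := pos_lt_card π u
  have hv := pos_lt_card π v
  have := r.2
  split_ifs with hw <;> rw [Finset.mem_Ico] at hw
  · rw [two_mul, ← sub_sub, add_sub_cancel, Sym2.eq_swap, ← Nat.cast_sub (by omega)]
    refine edgeLength_of_pos_add_eq ?_
    rw [pos_rotate, pos_rotate, if_neg (by omega), if_pos (by omega)]
    omega
  · rw [add_zero]
    refine edgeLength_of_pos_add_eq ?_
    rw [pos_rotate, pos_rotate]
    split_ifs <;> omega

theorem sum_edgeLength_rotate [Nonempty V] (π : Arrangement V) (u v : V) :
    ∑ r, edgeLength (rotate r π) s(u, v) =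
      2 * edgeLength π s(u, v) * (Fintype.card V - edgeLength π s(u, v)) := by
  wlog huv : pos π u ≤ pos π v generalizing u v
  · simpa only [Sym2.eq_swap (a := u)] using this v u (le_of_not_ge huv)
  obtain ⟨d, hd⟩ := Nat.exists_eq_add_of_le huv
  have hv := pos_lt_card π v
  have hsub : Finset.Ico (Fintype.card V - pos π v) (Fintype.card V - pos π u) ⊆
      Finset.range (Fintype.card V) := fun r hr => by
    rw [Finset.mem_Ico] at hr
    rw [Finset.mem_range]
    omega
  rw [edgeLength_of_pos_add_eq hd.symm, Finset.sum_congr rfl fun r _ => edgeLength_rotate hd.symm r,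
    Finset.sum_add_distrib, Fin.sum_univ_eq_sum_range (fun r => if r ∈
      Finset.Ico (Fintype.card V - pos π v) (Fintype.card V - pos π u) then
      (Fintype.card V : ℚ) - 2 * d else 0), Finset.sum_ite_mem, Finset.inter_eq_right.2 hsub,
    Finset.sum_const, Finset.sum_const, Finset.card_univ, Fintype.card_fin, Nat.card_Ico,
    show Fintype.card V - pos π u - (Fintype.card V - pos π v) = d by omega, nsmul_eq_mul,
    nsmul_eq_mul]
  ring

theorem edgeLength_eq_card_between_add_one (π : Arrangement V) {u v : V} (h : u ≠ v) :
    edgeLength π s(u, v) = (Finset.univ.filter (Between (pos π) u v)).card + 1 := by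
  wlog huv : pos π u < pos π v generalizing u v
  · have hne := (pos_injective π).ne h
    simpa only [Sym2.eq_swap (a := u), between_comm (p := u)] using this h.symm (by omega)
  have hcard : (Finset.univ.filter (Between (pos π) u v)).card = (Finset.Ioo (π u) (π v)).card := by
    refine Finset.card_equiv π fun x => ?_
    simp only [Between, Finset.mem_filter, Finset.mem_univ, true_and, Finset.mem_Ioo, Fin.lt_def]
    unfold pos at *
    omega
  rw [hcard, Fin.card_Ioo, edgeLength_of_pos_add_eq (d := π v - π u), ← Nat.cast_add_one]
  · congr 1
    unfold pos at huv
    omega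
  · unfold pos at *
    omega

end Length

section Pairs

theorem sum_sum_not_iff {α : Type*} (s : Finset α) (P : α → Prop) [DecidablePred P] :
    ∑ x ∈ s, ∑ y ∈ s, (if ¬ (P x ↔ P y) then 1 else 0) =
      2 * (s.filter P).card * (s.filter fun x => ¬ P x).card := by
  have hx (x : α) : ∑ y ∈ s, (if ¬ (P x ↔ P y) then 1 else 0) =
      if P x then (s.filter fun y => ¬ P y).card else (s.filter P).card := by
    rw [← Finset.card_filter]
    split_ifs with h <;> simp only [h, true_iff, false_iff, not_not]
  simp only [hx, Finset.sum_ite, Finset.sum_const, smul_eq_mul]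
  ring

theorem sum_sum_union_of_symm {α M : Type*} [DecidableEq α] [NonAssocSemiring M] {s t : Finset α}
    (h : Disjoint s t) {F : α → α → M} (hF : ∀ x y, F x y = F y x) :
    ∑ x ∈ s ∪ t, ∑ y ∈ s ∪ t, F x y = ∑ x ∈ s, ∑ y ∈ s, F x y + ∑ x ∈ t, ∑ y ∈ t, F x y +
      2 * ∑ x ∈ s, ∑ y ∈ t, F x y := by
  have hswap : ∑ x ∈ t, ∑ y ∈ s, F x y = ∑ x ∈ s, ∑ y ∈ t, F x y := by
    rw [Finset.sum_comm]
    exact Finset.sum_congr rfl fun x _ => Finset.sum_congr rfl fun y _ => hF y x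
  simp only [Finset.sum_union h, Finset.sum_add_distrib, hswap, two_mul]
  abel

variable {V : Type*} [Fintype V] [DecidableEq V]

theorem two_mul_edgeLength_mul (π : Arrangement V) {u v : V} (h : u ≠ v) :
    2 * edgeLength π s(u, v) * (Fintype.card V - edgeLength π s(u, v)) =
      2 * ((Fintype.card V : ℚ) - 1) + (∑ x ∈ {u, v}ᶜ, ∑ y ∈ {u, v}ᶜ,
        (if Separates (pos π) u v x y then 1 else 0) : ℕ) := by
  have hcompl : (({u, v}ᶜ : Finset V).filter fun x => Between (pos π) u v x) =
      Finset.univ.filter (Between (pos π) u v) := by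
    ext x
    simp only [Finset.mem_filter, Finset.mem_compl, Finset.mem_insert, Finset.mem_singleton,
      Finset.mem_univ, true_and, and_iff_right_iff_imp]
    rintro hx (rfl | rfl) <;> simp [Between] at hx
  have hcard : (Finset.univ.filter (Between (pos π) u v)).card +
      (({u, v}ᶜ : Finset V).filter fun x => ¬ Between (pos π) u v x).card + 2 =
        Fintype.card V := by
    rw [← hcompl, Finset.card_filter_add_card_filter_not, ← Finset.card_pair h,
      Finset.card_compl_add_card]
  have hpairs : ∑ x ∈ ({u, v}ᶜ : Finset V), ∑ y ∈ ({u, v}ᶜ : Finset V),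
      (if Separates (pos π) u v x y then 1 else 0) = _ :=
    sum_sum_not_iff _ (Between (pos π) u v)
  rw [hpairs, hcompl, edgeLength_eq_card_between_add_one π h, ← hcard]
  push_cast
  ring

end Pairs

section Expectation

variable {V : Type*} [Fintype V] [DecidableEq V] {T : SimpleGraph V}

/-- The vertices behind `u` as seen from its neighbour `v`: those `w ≠ u` for which `u` is on the
path from `v` to `w`. -/
noncomputable def behind (T : SimpleGraph V) (v u : V) : Finset V :=
  (Finset.univ.filter fun w => branch T v w = u).erase u

theorem mem_behind (hT : T.IsTree) {u v w : V} (h : T.Adj u v) :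
    w ∈ behind T v u ↔ w ≠ u ∧ branch T u w ≠ v := by
  simp [behind, branch_eq_iff_branch_ne hT h]

theorem card_behind_add_one (hT : T.IsTree) {u v : V} (h : T.Adj v u) :
    (behind T v u).card + 1 = subtreeSize T v u := by
  rw [behind, Finset.card_erase_add_one (by simpa using branch_of_adj hT h),
    subtreeSize_eq_card hT h]

theorem behind_union_behind (hT : T.IsTree) {u v : V} (h : T.Adj u v) :
    behind T v u ∪ behind T u v = {u, v}ᶜ := by
  ext w
  have := branch_eq_iff_branch_ne hT h w
  have := branch_self hT u
  have := branch_self hT v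
  have := h.ne
  simp only [Finset.mem_union, mem_behind hT h, mem_behind hT h.symm, Finset.mem_compl,
    Finset.mem_insert, Finset.mem_singleton]
  grind

theorem disjoint_behind (hT : T.IsTree) {u v : V} (h : T.Adj u v) :
    Disjoint (behind T v u) (behind T u v) := by
  rw [Finset.disjoint_left]
  intro w hu hv
  exact ((mem_behind hT h).1 hu).2
    ((branch_eq_iff_branch_ne hT h w).2 ((mem_behind hT h.symm).1 hv).2)

theorem card_filter_behind_branch_eq (hT : T.IsTree) {u v : V} (h : T.Adj u v)
    [Fintype (T.neighborSet u)] :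
    ((behind T v u ×ˢ behind T v u).filter fun p => branch T u p.1 = branch T u p.2).card =
      ∑ c ∈ (T.neighborFinset u).erase v, subtreeSize T u c ^ 2 := by
  rw [Finset.card_eq_sum_card_fiberwise (f := fun p => branch T u p.1)
    (t := (T.neighborFinset u).erase v)]
  · refine Finset.sum_congr rfl fun c hc => ?_
    obtain ⟨hcv, hc⟩ := Finset.mem_erase.1 hc
    rw [SimpleGraph.mem_neighborFinset] at hc
    rw [sq, subtreeSize_eq_card hT hc, ← Finset.card_product]
    congr 1
    ext ⟨x, y⟩
    have hne {w : V} (hw : branch T u w = c) : w ≠ u := fun hwu =>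
      hc.ne (((branch_eq_self_iff hT).2 hwu).symm.trans hw)
    simp only [Finset.mem_filter, Finset.mem_product, mem_behind hT h, Finset.mem_univ, true_and]
    grind
  · intro p hp
    have hp := ((mem_behind hT h).1 (Finset.mem_product.1 (Finset.mem_filter.1 hp).1).1)
    simpa [hp.2] using adj_branch hT hp.1

variable [DecidableRel T.Adj]

theorem sum_sum_card_separates_behind (hT : T.IsTree) {u v : V} (h : T.Adj u v) :
    3 * (∑ x ∈ behind T v u, ∑ y ∈ behind T v u,
        ((planarArrangements T).filter fun π => Separates (pos π) u v x y).card : ℚ) =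
      (planarArrangements T).card * (((subtreeSize T v u : ℚ) - 1) ^ 2 +
        (subtreeSize T u v : ℚ) ^ 2 - ∑ c ∈ T.neighborFinset u, (subtreeSize T u c : ℚ) ^ 2) := by
  have hterm : ∀ p ∈ behind T v u ×ˢ behind T v u,
      3 * ((planarArrangements T).filter fun π => Separates (pos π) u v p.1 p.2).card =
        if branch T u p.1 = branch T u p.2 then 0 else (planarArrangements T).card := by
    intro p hp
    obtain ⟨hx, hy⟩ := Finset.mem_product.1 hp
    obtain ⟨hx, hxv⟩ := (mem_behind hT h).1 hx
    obtain ⟨hy, hyv⟩ := (mem_behind hT h).1 hy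
    split_ifs with hxy
    · rw [Finset.filter_false_of_mem fun π hπ =>
        not_separates_of_branch_eq hT hπ h hx hy hxy hxv, Finset.card_empty]
    · exact three_mul_card_separates hT h hx hy hxy hxv hyv
  have hcard := Finset.card_filter_add_card_filter_not (s := behind T v u ×ˢ behind T v u)
    fun p => branch T u p.1 = branch T u p.2
  have hpairs : 3 * ∑ x ∈ behind T v u, ∑ y ∈ behind T v u,
      ((planarArrangements T).filter fun π => Separates (pos π) u v x y).card =
      (planarArrangements T).card * ((behind T v u ×ˢ behind T v u).filter
        fun p => ¬ branch T u p.1 = branch T u p.2).card := by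
    rw [← Finset.sum_product', Finset.mul_sum, Finset.sum_congr rfl hterm, Finset.sum_ite,
      Finset.sum_const_zero, zero_add, Finset.sum_const, smul_eq_mul, mul_comm]
  rw [card_filter_behind_branch_eq hT h, Finset.card_product] at hcard
  rw [← Finset.sum_erase_add _ _ ((T.mem_neighborFinset u v).2 h), ← card_behind_add_one hT h.symm]
  have hcard' := congrArg (Nat.cast (R := ℚ)) hcard
  have hpairs' := congrArg (Nat.cast (R := ℚ)) hpairs
  push_cast at hcard' hpairs' ⊢
  linear_combination hpairs' + ((planarArrangements T).card : ℚ) * hcard'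

theorem sum_sum_card_separates_behind_behind (hT : T.IsTree) {u v : V} (h : T.Adj u v) :
    2 * (∑ x ∈ behind T v u, ∑ y ∈ behind T u v,
        ((planarArrangements T).filter fun π => Separates (pos π) u v x y).card : ℚ) =
      (planarArrangements T).card * (((subtreeSize T v u : ℚ) - 1) * (subtreeSize T u v - 1)) := by
  rw [← card_behind_add_one hT h, ← card_behind_add_one hT h.symm]
  have hterm : ∀ x ∈ behind T v u, ∀ y ∈ behind T u v,
      2 * ((planarArrangements T).filter fun π => Separates (pos π) u v x y).card =
        (planarArrangements T).card := by
    intro x hx y hy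
    obtain ⟨hx, hxv⟩ := (mem_behind hT h).1 hx
    obtain ⟨hy, hyu⟩ := (mem_behind hT h.symm).1 hy
    exact two_mul_card_separates hT h hx hy hxv ((branch_eq_iff_branch_ne hT h y).2 hyu)
  have hpairs : 2 * ∑ x ∈ behind T v u, ∑ y ∈ behind T u v,
      ((planarArrangements T).filter fun π => Separates (pos π) u v x y).card =
      (behind T v u).card * ((behind T u v).card * (planarArrangements T).card) := by
    simp only [Finset.mul_sum]
    rw [Finset.sum_congr rfl fun x hx => Finset.sum_congr rfl (hterm x hx), Finset.sum_const,
      Finset.sum_const, smul_eq_mul, smul_eq_mul]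
  have := congrArg (Nat.cast (R := ℚ)) hpairs
  push_cast at this ⊢
  linear_combination this

theorem card_mul_sum_edgeLength [Nonempty V] (u v : V) :
    Fintype.card V * ∑ π ∈ planarArrangements T, edgeLength π s(u, v) =
      ∑ π ∈ planarArrangements T,
        2 * edgeLength π s(u, v) * (Fintype.card V - edgeLength π s(u, v)) := by
  simp only [← sum_edgeLength_rotate]
  rw [Finset.sum_comm, Finset.sum_congr rfl fun r _ =>
    sum_planarArrangements_rotate (fun π => edgeLength π s(u, v)) r]
  simp

theorem sum_edgeLength_eq (hT : T.IsTree) {u v : V} (h : T.Adj u v) :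
    Fintype.card V * ∑ π ∈ planarArrangements T, edgeLength π s(u, v) =
      (planarArrangements T).card * ((3 * (Fintype.card V : ℚ) ^ 2 + 2 * Fintype.card V - 2) / 6 +
        ((subtreeSize T u v : ℚ) ^ 2 + (subtreeSize T v u : ℚ) ^ 2) / 6 -
        (∑ c ∈ T.neighborFinset u, (subtreeSize T u c : ℚ) ^ 2 +
          ∑ c ∈ T.neighborFinset v, (subtreeSize T v c : ℚ) ^ 2) / 3) := by
  have : Nonempty V := ⟨u⟩
  have hpairs : ∑ π ∈ planarArrangements T, (∑ x ∈ {u, v}ᶜ, ∑ y ∈ {u, v}ᶜ,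
      (if Separates (pos π) u v x y then 1 else 0) : ℕ) = ∑ x ∈ {u, v}ᶜ, ∑ y ∈ {u, v}ᶜ,
        ((planarArrangements T).filter fun π => Separates (pos π) u v x y).card := by
    simp only [Finset.card_filter]
    rw [Finset.sum_comm]
    exact Finset.sum_congr rfl fun x _ => Finset.sum_comm
  have hsymm (x y : V) : ((planarArrangements T).filter fun π => Separates (pos π) u v x y).card =
      ((planarArrangements T).filter fun π => Separates (pos π) u v y x).card :=
    congrArg Finset.card (Finset.filter_congr fun _ _ => separates_comm_right)
  have hA := sum_sum_card_separates_behind hT h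
  have hB := sum_sum_card_separates_behind hT h.symm
  have hAB := sum_sum_card_separates_behind_behind hT h
  simp only [separates_comm_left (p := v)] at hB
  rw [card_mul_sum_edgeLength, Finset.sum_congr rfl fun π _ => two_mul_edgeLength_mul π h.ne,
    Finset.sum_add_distrib, Finset.sum_const, nsmul_eq_mul, ← Nat.cast_sum, hpairs,
    ← behind_union_behind hT h, sum_sum_union_of_symm (disjoint_behind hT h) hsymm,
    ← subtreeSize_add_subtreeSize hT h]
  push_cast
  linear_combination hA / 3 + hB / 3 + hAB

end Expectation

/-! ### The expected sum of edge lengths -/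

section Expectation

variable {V : Type*} [Fintype V] {T : SimpleGraph V} [DecidableRel T.Adj]

theorem sum_darts_eq_sum_neighborFinset {M : Type*} [AddCommMonoid M] (F : V → V → M) :
    ∑ d : T.Dart, F d.fst d.snd = ∑ u, ∑ v ∈ T.neighborFinset u, F u v := by
  rw [Finset.sum_sigma']
  refine Finset.sum_bij' (fun d _ => ⟨d.fst, d.snd⟩)
    (fun p hp => ⟨(p.1, p.2), by simpa using hp⟩) ?_ ?_ ?_ ?_ ?_ <;> simp

theorem sum_degree_eq (hT : T.IsTree) : ∑ v, (T.degree v : ℚ) = 2 * ((Fintype.card V : ℚ) - 1) := by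
  rw [← Nat.cast_sum, T.sum_degrees_eq_twice_card_edges, ← hT.card_edgeFinset]
  push_cast
  ring

theorem sum_neighborFinset_comm {M : Type*} [AddCommMonoid M] (F : V → V → M) :
    ∑ u, ∑ v ∈ T.neighborFinset u, F u v = ∑ u, ∑ v ∈ T.neighborFinset u, F v u :=
  Finset.sum_comm' fun u v => by simp [T.adj_comm]

theorem two_mul_sum_edgeFinset {R : Type*} [CommSemiring R] (g : Sym2 V → R) :
    2 * ∑ e ∈ T.edgeFinset, g e = ∑ u, ∑ v ∈ T.neighborFinset u, g s(u, v) := by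
  classical
  rw [← sum_darts_eq_sum_neighborFinset (T := T) fun u v => g s(u, v), Finset.mul_sum,
    ← Finset.sum_fiberwise_of_maps_to (g := SimpleGraph.Dart.edge)
      fun d _ => SimpleGraph.mem_edgeFinset.2 d.edge_mem]
  refine Finset.sum_congr rfl fun e he => ?_
  have hcard := T.dart_edge_fiber_card e (SimpleGraph.mem_edgeFinset.1 he)
  have hconst : ∀ d ∈ Finset.univ.filter fun d : T.Dart => d.edge = e,
      g s(d.fst, d.snd) = g e := fun d hd => congrArg g (Finset.mem_filter.1 hd).2
  rw [Finset.sum_congr rfl hconst, Finset.sum_const, hcard, nsmul_eq_mul, Nat.cast_ofNat]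

variable [DecidableEq V]

theorem card_mul_sum_sumEdgeLengths (hT : T.IsTree) :
    6 * Fintype.card V * ∑ π ∈ planarArrangements T, sumEdgeLengths T π =
      (planarArrangements T).card * (((Fintype.card V : ℚ) - 1) *
        (3 * (Fintype.card V : ℚ) ^ 2 + 2 * Fintype.card V - 2) -
          ∑ v, (2 * (T.degree v : ℚ) - 1) *
            ∑ u ∈ T.neighborFinset v, (subtreeSize T v u : ℚ) ^ 2) := by
  set C : ℚ := 3 * (Fintype.card V : ℚ) ^ 2 + 2 * Fintype.card V - 2 with hC
  let S (v : V) : ℚ := ∑ u ∈ T.neighborFinset v, (subtreeSize T v u : ℚ) ^ 2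
  have hedge (u : V) : ∀ v ∈ T.neighborFinset u,
      6 * (Fintype.card V * ∑ π ∈ planarArrangements T, edgeLength π s(u, v)) =
        (planarArrangements T).card * (C + ((subtreeSize T u v : ℚ) ^ 2 +
          (subtreeSize T v u : ℚ) ^ 2) - 2 * (S u + S v)) := fun v hv => by
    rw [sum_edgeLength_eq hT ((T.mem_neighborFinset u v).1 hv), ← hC]
    ring
  have hsum : 2 * (6 * Fintype.card V * ∑ π ∈ planarArrangements T, sumEdgeLengths T π) =
      ∑ u, ∑ v ∈ T.neighborFinset u, (planarArrangements T).card * (C +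
        ((subtreeSize T u v : ℚ) ^ 2 + (subtreeSize T v u : ℚ) ^ 2) - 2 * (S u + S v)) := by
    simp only [sumEdgeLengths]
    rw [Finset.sum_comm, Finset.mul_sum, two_mul_sum_edgeFinset]
    simp only [mul_assoc]
    exact Finset.sum_congr rfl fun u _ => Finset.sum_congr rfl (hedge u)
  have hconst (f : V → ℚ) : ∑ u, ∑ _v ∈ T.neighborFinset u, f u = ∑ u, T.degree u * f u := by
    simp
  simp only [← Finset.mul_sum, Finset.sum_add_distrib, Finset.sum_sub_distrib] at hsum
  rw [sum_neighborFinset_comm fun _ v => S v,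
    sum_neighborFinset_comm fun u v => (subtreeSize T v u : ℚ) ^ 2, hconst, hconst,
    ← Finset.sum_mul, sum_degree_eq hT] at hsum
  change _ = _ * (_ - ∑ v, (2 * (T.degree v : ℚ) - 1) * S v)
  simp only [sub_mul, one_mul, mul_assoc, Finset.sum_sub_distrib, ← Finset.mul_sum] at hsum ⊢
  linear_combination hsum / 2

theorem expectedPlanarD_eq (hT : T.IsTree) {n : ℕ} (hn : Fintype.card V = n) :
    expectedPlanarD T =
      ((n : ℚ) - 1) * (3 * (n : ℚ) ^ 2 + 2 * (n : ℚ) - 2) / (6 * (n : ℚ)) -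
        1 / (6 * (n : ℚ)) *
          ∑ v : V, (2 * (T.degree v : ℚ) - 1) *
            ∑ u ∈ T.neighborFinset v, (subtreeSize T v u : ℚ) ^ 2 := by
  subst hn
  have : Nonempty V := hT.1.nonempty
  have hV : (Fintype.card V : ℚ) ≠ 0 := by exact_mod_cast Fintype.card_ne_zero
  have hP : ((planarArrangements T).card : ℚ) ≠ 0 := by
    exact_mod_cast (planarArrangements_nonempty hT).card_ne_zero
  rw [expectedPlanarD, Finset.expect_eq_sum_div_card]
  field_simp
  linear_combination card_mul_sum_sumEdgeLengths hT

end Expectation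

/-! ### A structured language and its compilation -/

/-- The program `P` leads from one configuration to the other in `k` steps, and no register
exceeds `B` meanwhile. -/
def Steps (P : List Instr) (I : List ℕ) (B : ℕ) (c : Config) (k : ℕ) (c' : Config) : Prop :=
  (step P I)^[k] c = c' ∧ ∀ j ≤ k, ∀ r, ((step P I)^[j] c).reg r ≤ B

section Steps

variable {P : List Instr} {I : List ℕ} {B : ℕ}

theorem Steps.refl {c : Config} (h : ∀ r, c.reg r ≤ B) : Steps P I B c 0 c := by
  refine ⟨rfl, fun j hj r => ?_⟩
  obtain rfl : j = 0 := by omega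
  exact h r

theorem Steps.trans {c c' c'' : Config} {k l : ℕ} (h : Steps P I B c k c')
    (h' : Steps P I B c' l c'') : Steps P I B c (k + l) c'' := by
  refine ⟨by rw [Nat.add_comm, Function.iterate_add_apply, h.1, h'.1], fun j hj r => ?_⟩
  by_cases hjk : j ≤ k
  · exact h.2 j hjk r
  · obtain ⟨m, rfl⟩ := Nat.exists_eq_add_of_lt (not_le.1 hjk)
    rw [show k + m + 1 = (m + 1) + k by omega, Function.iterate_add_apply, h.1]
    exact h'.2 _ (by omega) r

theorem Steps.reg_le {c c' : Config} {k : ℕ} (h : Steps P I B c k c') (r : ℕ) :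
    c'.reg r ≤ B := by
  rw [← h.1]
  exact h.2 k le_rfl r

theorem Steps.single {c c' : Config} {i : Instr} (hi : P[c.pc]? = some i)
    (hc : ∀ r, c.reg r ≤ B) (hc' : ∀ r, c'.reg r ≤ B) (he : i.exec I c = c') :
    Steps P I B c 1 c' := by
  have hs : step P I c = c' := by
    rw [step, hi]
    exact he
  refine ⟨hs, fun j hj r => ?_⟩
  obtain rfl | rfl : j = 0 ∨ j = 1 := by omega
  · exact hc r
  · rw [Function.iterate_one, hs]
    exact hc' r

theorem Steps.jump {pc l : ℕ} {R : ℕ → ℕ} (hi : P[pc]? = some (.jump l)) (hR : ∀ r, R r ≤ B) :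
    Steps P I B ⟨pc, R⟩ 1 ⟨l, R⟩ :=
  .single hi hR hR rfl

theorem Steps.jumpZero_of_eq {pc a l : ℕ} {R : ℕ → ℕ} (hi : P[pc]? = some (.jumpZero a l))
    (hR : ∀ r, R r ≤ B) (ha : R a = 0) : Steps P I B ⟨pc, R⟩ 1 ⟨l, R⟩ :=
  .single hi hR hR (by simp [Instr.exec, ha])

theorem Steps.jumpZero_of_ne {pc a l : ℕ} {R : ℕ → ℕ} (hi : P[pc]? = some (.jumpZero a l))
    (hR : ∀ r, R r ≤ B) (ha : R a ≠ 0) : Steps P I B ⟨pc, R⟩ 1 ⟨pc + 1, R⟩ :=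
  .single hi hR hR (by simp [Instr.exec, ha])

theorem Steps.computesWithin {k time a b : ℕ} {c : Config} (h : Steps P I B Config.init k c)
    (hpc : P.length ≤ c.pc) (ha : c.reg 0 = a) (hb : c.reg 1 = b) (hk : k ≤ time) :
    ComputesWithin P I time B a b := by
  have hhalt : step P I c = c := by
    rw [step, List.getElem?_eq_none hpc]
  have hrun : ∀ j, runFor P I (j + k) = c := fun j => by
    rw [runFor, Function.iterate_add_apply, h.1, Function.iterate_fixed hhalt]
  have htime : runFor P I time = c := by
    rw [← Nat.sub_add_cancel hk, hrun]
  refine ⟨htime ▸ hpc, htime ▸ ha, htime ▸ hb, fun t r => ?_⟩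
  rcases le_total t k with ht | ht
  · exact h.2 t ht r
  · rw [← Nat.sub_add_cancel ht, hrun]
    exact h.reg_le r

/-- Straight-line code: wherever `l` stands in a program, running through it turns the registers
`R` into `R'`, and no register exceeds `B` meanwhile. -/
def Straight (I : List ℕ) (B : ℕ) (l : List Instr) (R R' : ℕ → ℕ) : Prop :=
  ∀ ⦃P : List Instr⦄ ⦃pc : ℕ⦄ ⦃rest : List Instr⦄, P.drop pc = l ++ rest →
    Steps P I B ⟨pc, R⟩ l.length ⟨pc + l.length, R'⟩

variable {l l' : List Instr} {R R' R'' : ℕ → ℕ}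

theorem drop_add_length {α : Type*} {P l l' : List α} {pc : ℕ} (h : P.drop pc = l ++ l') :
    P.drop (pc + l.length) = l' := by
  rw [← List.drop_drop, h, List.drop_left]

theorem getElem?_of_drop_eq_cons {α : Type*} {P l : List α} {i : α} {pc : ℕ}
    (h : P.drop pc = i :: l) : P[pc]? = some i := by
  rw [← Nat.add_zero pc, ← List.getElem?_drop, h, List.getElem?_cons_zero]

theorem Straight.nil (hR : ∀ r, R r ≤ B) : Straight I B [] R R :=
  fun _ _ _ _ => .refl hR

theorem Straight.append (h : Straight I B l R R') (h' : Straight I B l' R' R'') :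
    Straight I B (l ++ l') R R'' := by
  intro P pc rest hP
  rw [List.append_assoc] at hP
  have := (h hP).trans (h' (drop_add_length hP))
  rwa [List.length_append, ← Nat.add_assoc]

theorem Straight.reg_le (h : Straight I B l R R') (r : ℕ) : R' r ≤ B :=
  (h (P := l) (pc := 0) (rest := []) (by simp)).reg_le r

theorem Straight.single {i : Instr} {d v : ℕ} (hR : ∀ r, R r ≤ B) (hv : v ≤ B)
    (hi : ∀ pc, i.exec I ⟨pc, R⟩ = ⟨pc + 1, Function.update R d v⟩) :
    Straight I B [i] R (Function.update R d v) := by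
  intro P pc rest hP
  refine .single (i := i) (getElem?_of_drop_eq_cons hP) hR (fun r => ?_) (hi pc)
  by_cases h : r = d <;> simp [h, hv, hR]

end Steps

/-- The scalar variables of the program. -/
inductive Var
  | numerator | denominator | order | left | cursor | fst | snd | index | vertex | parent
  | weight | total
  deriving DecidableEq

/-- The arrays of the program, indexed by the vertices. -/
inductive Table
  | degree | remaining | nbrSum | size
  deriving DecidableEq

/-- A memory cell of the structured language. -/
inductive Cell
  | var (x : Var)
  | entry (t : Table) (i : ℕ)
  deriving DecidableEq

/-- The register of a cell. Variables are kept below `16`, with the results in registers `0`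
and `1`; from there on the four arrays and the temporaries of `temp` are interleaved. -/
def Cell.addr : Cell → ℕ
  | .var x => x.ctorIdx
  | .entry t i => 5 * i + (16 + t.ctorIdx)

/-- The registers that hold intermediate values of expressions. -/
def temp (d : ℕ) : ℕ := 5 * d + 20

theorem Var.ctorIdx_lt (x : Var) : x.ctorIdx < 16 := by
  cases x <;> decide

theorem Table.ctorIdx_lt (t : Table) : t.ctorIdx < 4 := by
  cases t <;> decide

theorem Cell.addr_injective : Function.Injective Cell.addr := by
  rintro (x | ⟨t, i⟩) (y | ⟨u, j⟩) h
  · cases x <;> cases y <;> first | rfl | cases h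
  · have := x.ctorIdx_lt
    simp only [Cell.addr] at h
    omega
  · have := y.ctorIdx_lt
    simp only [Cell.addr] at h
    omega
  · have ht := t.ctorIdx_lt
    have hu := u.ctorIdx_lt
    simp only [Cell.addr] at h
    obtain rfl : i = j := by omega
    have htu : t.ctorIdx = u.ctorIdx := by omega
    cases t <;> cases u <;> first | rfl | cases htu

theorem Cell.addr_ne_temp (c : Cell) (d : ℕ) : c.addr ≠ temp d := by
  rcases c with x | ⟨t, i⟩
  · have := x.ctorIdx_lt
    simp only [Cell.addr, temp]
    omega
  · have := t.ctorIdx_lt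
    simp only [Cell.addr, temp]
    omega

theorem temp_injective : Function.Injective temp := fun d e h => by
  simp only [temp] at h
  omega

/-- The contents of all cells. -/
abbrev Store := Cell → ℕ

/-- The registers `R` hold the contents `σ` of the cells. -/
def Represents (R : ℕ → ℕ) (σ : Store) : Prop :=
  ∀ c : Cell, R c.addr = σ c

theorem Represents.update_temp {R : ℕ → ℕ} {σ : Store} (h : Represents R σ) (d v : ℕ) :
    Represents (Function.update R (temp d) v) σ := fun c => by
  rw [Function.update_of_ne (c.addr_ne_temp d), h c]

theorem Represents.update_addr {R : ℕ → ℕ} {σ : Store} (h : Represents R σ) (c : Cell) (v : ℕ) :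
    Represents (Function.update R c.addr v) (Function.update σ c v) := fun c' => by
  rw [Function.update_apply_of_injective _ Cell.addr_injective, funext h]

/-- Expressions of the structured language: literals, variables, sums, truncated differences,
products, input cells, and array entries. -/
inductive Expr
  | lit (k : ℕ)
  | var (x : Var)
  | add (a b : Expr)
  | sub (a b : Expr)
  | mul (a b : Expr)
  | input (a : Expr)
  | get (t : Table) (a : Expr)

/-- The value of an expression on input `I`. -/
def Expr.eval (I : List ℕ) (σ : Store) : Expr → ℕ
  | .lit k => k
  | .var x => σ (.var x)
  | .add a b => a.eval I σ + b.eval I σ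
  | .sub a b => a.eval I σ - b.eval I σ
  | .mul a b => a.eval I σ * b.eval I σ
  | .input a => I.getD (a.eval I σ) 0
  | .get t a => σ (.entry t (a.eval I σ))

/-- The expression can be evaluated without exceeding `B`, as long as no cell does. -/
def Expr.Safe (I : List ℕ) (B : ℕ) (σ : Store) : Expr → Prop
  | .lit k => k ≤ B
  | .var _ => True
  | .add a b => a.Safe I B σ ∧ b.Safe I B σ ∧ a.eval I σ + b.eval I σ ≤ B
  | .sub a b => a.Safe I B σ ∧ b.Safe I B σ
  | .mul a b => a.Safe I B σ ∧ b.Safe I B σ ∧ a.eval I σ * b.eval I σ ≤ B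
  | .input a => a.Safe I B σ ∧ I.getD (a.eval I σ) 0 ≤ B
  | .get _ a => a.Safe I B σ ∧ 5 * a.eval I σ + 20 ≤ B

/-- Turns the index in the temporary `d` into the register of the entry of `t` there. -/
def addressCode (t : Table) (d : ℕ) : List Instr :=
  [.const (temp (d + 1)) 5, .mul (temp d) (temp (d + 1)) (temp d),
    .const (temp (d + 1)) (16 + t.ctorIdx), .add (temp d) (temp d) (temp (d + 1))]

/-- Code that evaluates an expression into the temporary `d`, without changing lower ones. -/
def Expr.code (d : ℕ) : Expr → List Instr
  | .lit k => [.const (temp d) k]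
  | .var x => [.const (temp d) 0, .add (temp d) (temp d) (Cell.var x).addr]
  | .add a b => a.code d ++ (b.code (d + 1) ++ [.add (temp d) (temp d) (temp (d + 1))])
  | .sub a b => a.code d ++ (b.code (d + 1) ++ [.sub (temp d) (temp d) (temp (d + 1))])
  | .mul a b => a.code d ++ (b.code (d + 1) ++ [.mul (temp d) (temp d) (temp (d + 1))])
  | .input a => a.code d ++ [.read (temp d) (temp d)]
  | .get t a => a.code d ++ (addressCode t d ++ [.load (temp d) (temp d)])

section Evaluates

variable {I : List ℕ} {B d : ℕ} {σ : Store} {l l' : List Instr} {R R' R'' : ℕ → ℕ} {v w z : ℕ}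

/-- The straight-line code `l` leaves the value `v` in the temporary `d`, and changes neither
the cells nor the lower temporaries. -/
structure Evaluates (I : List ℕ) (B : ℕ) (σ : Store) (d : ℕ) (l : List Instr) (R : ℕ → ℕ)
    (v : ℕ) (R' : ℕ → ℕ) : Prop where
  straight : Straight I B l R R'
  represents : Represents R' σ
  value : R' (temp d) = v
  temp_eq : ∀ j < d, R' (temp j) = R (temp j)

theorem Evaluates.append_single {i : Instr} (h : Straight I B l R R') (hσ : Represents R' σ)
    (htemp : ∀ j < d, R' (temp j) = R (temp j)) (hz : z ≤ B)
    (hi : ∀ pc, i.exec I ⟨pc, R'⟩ = ⟨pc + 1, Function.update R' (temp d) z⟩) :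
    Evaluates I B σ d (l ++ [i]) R z (Function.update R' (temp d) z) where
  straight := h.append (.single h.reg_le hz hi)
  represents := hσ.update_temp d z
  value := Function.update_self ..
  temp_eq j hj := by rw [Function.update_of_ne (temp_injective.ne hj.ne), htemp j hj]

theorem Evaluates.append_binary {i : Instr} (h : Evaluates I B σ d l R v R')
    (h' : Evaluates I B σ (d + 1) l' R' w R'') (hz : z ≤ B)
    (hi : ∀ pc, i.exec I ⟨pc, R''⟩ = ⟨pc + 1, Function.update R'' (temp d) z⟩) :
    Evaluates I B σ d (l ++ (l' ++ [i])) R z (Function.update R'' (temp d) z) := by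
  rw [← List.append_assoc]
  exact .append_single (h.straight.append h'.straight) h'.represents
    (fun j hj => (h'.temp_eq j (by omega)).trans (h.temp_eq j hj)) hz hi

theorem Evaluates.const (hσ : Represents R σ) (hR : ∀ r, R r ≤ B) (hv : v ≤ B) :
    Evaluates I B σ d [.const (temp d) v] R v (Function.update R (temp d) v) :=
  .append_single (.nil hR) hσ (fun _ _ => rfl) hv fun _ => rfl

theorem Evaluates.append_addressCode (h : Evaluates I B σ d l R v R') (t : Table)
    (hv : 5 * v + 20 ≤ B) :
    ∃ R'', Evaluates I B σ d (l ++ addressCode t d) R (Cell.entry t v).addr R'' := by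
  have ht := t.ctorIdx_lt
  have hfactor := Evaluates.const (I := I) (d := d + 1) (v := 5) h.represents h.straight.reg_le
    (by omega)
  have hmul := h.append_binary (i := .mul (temp d) (temp (d + 1)) (temp d)) (z := 5 * v) hfactor
    (by omega) (fun pc => by
      simp only [Instr.exec, hfactor.value, hfactor.temp_eq d (by omega), h.value])
  have hoffset := Evaluates.const (I := I) (d := d + 1) (v := 16 + t.ctorIdx) hmul.represents
    hmul.straight.reg_le (by omega)
  have hadd := hmul.append_binary (i := .add (temp d) (temp d) (temp (d + 1)))
    (z := (Cell.entry t v).addr) hoffset (by simp only [Cell.addr]; omega) (fun pc => by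
      simp only [Instr.exec, hoffset.value, hoffset.temp_eq d (by omega), hmul.value, Cell.addr])
  rw [List.append_assoc] at hadd
  exact ⟨_, hadd⟩

theorem Expr.exists_evaluates (e : Expr) (hσ : Represents R σ) (hR : ∀ r, R r ≤ B)
    (he : e.Safe I B σ) : ∃ R', Evaluates I B σ d (e.code d) R (e.eval I σ) R' := by
  induction e generalizing d R with
  | lit k => exact ⟨_, .const hσ hR he⟩
  | var x =>
    have hzero := Evaluates.const (I := I) (d := d) hσ hR B.zero_le
    refine ⟨_, .append_single (i := .add (temp d) (temp d) (Cell.var x).addr)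
      hzero.straight hzero.represents hzero.temp_eq (z := σ (.var x)) (hσ (.var x) ▸ hR _) ?_⟩
    intro pc
    simp only [Instr.exec, hzero.value, hzero.represents (.var x), zero_add]
  | add a b iha ihb | sub a b iha ihb | mul a b iha ihb =>
    obtain ⟨Ra, ha⟩ := iha hσ hR he.1 (d := d)
    obtain ⟨Rb, hb⟩ := ihb ha.represents ha.straight.reg_le (by first | exact he.2.1 | exact he.2)
      (d := d + 1)
    refine ⟨_, ha.append_binary hb ?_ fun pc => ?_⟩
    rotate_left
    · simp only [Instr.exec, hb.temp_eq d (by omega), ha.value, hb.value, Expr.eval]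
    · first
      | exact he.2.2
      | exact (Nat.sub_le _ _).trans (ha.value ▸ ha.straight.reg_le _)
  | input a iha =>
    obtain ⟨Ra, ha⟩ := iha hσ hR he.1 (d := d)
    exact ⟨_, .append_single ha.straight ha.represents ha.temp_eq he.2 fun pc => by
      simp only [Instr.exec, ha.value, Expr.eval]⟩
  | get t a iha =>
    obtain ⟨Ra, ha⟩ := iha hσ hR he.1 (d := d)
    obtain ⟨Rt, ht⟩ := ha.append_addressCode t he.2
    rw [Expr.code, ← List.append_assoc]
    refine ⟨_, .append_single ht.straight ht.represents ht.temp_eq ?_ fun pc => by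
      simp only [Instr.exec, ht.value, ht.represents (.entry t (a.eval I σ)), Expr.eval]⟩
    rw [Expr.eval, ← ht.represents]
    exact ht.straight.reg_le _

end Evaluates

/-- Assignments to a variable or to an array entry. -/
inductive Stmt
  | set (x : Var) (e : Expr)
  | put (t : Table) (i e : Expr)

/-- The store after an assignment. -/
def Stmt.run (I : List ℕ) (σ : Store) : Stmt → Store
  | .set x e => Function.update σ (.var x) (e.eval I σ)
  | .put t i e => Function.update σ (.entry t (i.eval I σ)) (e.eval I σ)

/-- The assignment can be carried out without exceeding `B`, as long as no cell does. -/
def Stmt.Safe (I : List ℕ) (B : ℕ) (σ : Store) : Stmt → Prop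
  | .set _ e => e.Safe I B σ
  | .put _ i e => i.Safe I B σ ∧ 5 * i.eval I σ + 20 ≤ B ∧ e.Safe I B σ

/-- Code for an assignment. -/
def Stmt.code : Stmt → List Instr
  | .set x e => e.code 0 ++ [.const (temp 1) 0, .add (Cell.var x).addr (temp 0) (temp 1)]
  | .put t i e => i.code 0 ++ addressCode t 0 ++ e.code 1 ++ [.store (temp 0) (temp 1)]

/-- The weakest precondition of a list of assignments for the postcondition `Q` and the
bound `B`. -/
def Stmt.Wp (I : List ℕ) (B : ℕ) (Q : Store → Prop) : List Stmt → Store → Prop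
  | [], σ => Q σ
  | s :: l, σ => s.Safe I B σ ∧ Stmt.Wp I B Q l (s.run I σ)

section Stmt

variable {I : List ℕ} {B : ℕ} {σ : Store} {R : ℕ → ℕ} {Q : Store → Prop}

theorem Stmt.exists_straight (s : Stmt) (hσ : Represents R σ) (hR : ∀ r, R r ≤ B)
    (hs : s.Safe I B σ) : ∃ R', Straight I B s.code R R' ∧ Represents R' (s.run I σ) := by
  cases s with
  | set x e =>
    obtain ⟨Re, he⟩ := e.exists_evaluates hσ hR hs (d := 0)
    have hzero := Evaluates.const (I := I) (d := 1) he.represents he.straight.reg_le B.zero_le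
    have hv : e.eval I σ ≤ B := he.value ▸ he.straight.reg_le _
    refine ⟨_, he.straight.append (hzero.straight.append (.single hzero.straight.reg_le hv
      fun pc => ?_)), hzero.represents.update_addr (.var x) (e.eval I σ)⟩
    simp only [Instr.exec, hzero.value, hzero.temp_eq 0 one_pos, he.value, add_zero]
  | put t i e =>
    obtain ⟨Ri, hi⟩ := i.exists_evaluates hσ hR hs.1 (d := 0)
    obtain ⟨Rt, ht⟩ := hi.append_addressCode t hs.2.1
    obtain ⟨Re, he⟩ := e.exists_evaluates ht.represents ht.straight.reg_le hs.2.2 (d := 1)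
    have hv : e.eval I σ ≤ B := he.value ▸ he.straight.reg_le _
    refine ⟨_, (ht.straight.append he.straight).append (.single he.straight.reg_le hv
      fun pc => ?_), he.represents.update_addr (.entry t (i.eval I σ)) (e.eval I σ)⟩
    simp only [Instr.exec, he.value, he.temp_eq 0 one_pos, ht.value]

theorem Stmt.Wp.exists_straight {l : List Stmt} (hσ : Represents R σ) (hR : ∀ r, R r ≤ B)
    (h : Stmt.Wp I B Q l σ) :
    ∃ R' σ', Straight I B (l.flatMap Stmt.code) R R' ∧ Represents R' σ' ∧ Q σ' := by
  induction l generalizing R σ with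
  | nil => exact ⟨R, σ, .nil hR, hσ, h⟩
  | cons s l ih =>
    obtain ⟨Rs, hs, hσs⟩ := s.exists_straight hσ hR h.1
    obtain ⟨R', σ', hl, hσ', hQ⟩ := ih hσs hs.reg_le h.2
    exact ⟨R', σ', hs.append hl, hσ', hQ⟩

end Stmt

/-- Structured programs: blocks of assignments, sequences, branching, where `c` is chosen if the
value of `e` is not `0`, and the loop that repeats `c` while it is not. -/
inductive Code
  | block (l : List Stmt)
  | seq (c d : Code)
  | cond (e : Expr) (c d : Code)
  | loop (e : Expr) (c : Code)

/-- The compilation of a structured program that is to be placed at instruction `pc`. -/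
def Code.compile (pc : ℕ) : Code → List Instr
  | .block l => l.flatMap Stmt.code
  | .seq c d => c.compile pc ++ d.compile (pc + (c.compile pc).length)
  | .cond e c d =>
    let pos := pc + (e.code 0).length + 1
    let neg := pos + (c.compile pos).length + 1
    e.code 0 ++ .jumpZero (temp 0) neg :: (c.compile pos ++
      .jump (neg + (d.compile neg).length) :: d.compile neg)
  | .loop e c =>
    let pos := pc + (e.code 0).length + 1
    e.code 0 ++ .jumpZero (temp 0) (pos + (c.compile pos).length + 1) :: (c.compile pos ++
      [.jump pc])

/-- Total correctness with a time bound: from the store `σ` the program `c` comes to its end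
within `T` steps and without exceeding `B`, in a store that satisfies `Q`. -/
def Code.Runs (I : List ℕ) (B : ℕ) (c : Code) (σ : Store) (T : ℕ) (Q : Store → Prop) : Prop :=
  ∀ ⦃P : List Instr⦄ ⦃pc : ℕ⦄ ⦃rest : List Instr⦄ ⦃R : ℕ → ℕ⦄,
    P.drop pc = c.compile pc ++ rest → Represents R σ → (∀ r, R r ≤ B) →
    ∃ t ≤ T, ∃ R' σ', Steps P I B ⟨pc, R⟩ t ⟨pc + (c.compile pc).length, R'⟩ ∧
      Represents R' σ' ∧ Q σ'

section Runs

variable {I : List ℕ} {B : ℕ} {σ : Store} {Q Q' : Store → Prop} {c d : Code} {e : Expr} {S T : ℕ}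

theorem Code.Runs.mono (h : c.Runs I B σ S Q) (hST : S ≤ T) (hQ : ∀ σ', Q σ' → Q' σ') :
    c.Runs I B σ T Q' := by
  intro P pc rest R hP hσ hR
  obtain ⟨t, ht, R', σ', hsteps, hσ', hQσ⟩ := h hP hσ hR
  exact ⟨t, ht.trans hST, R', σ', hsteps, hσ', hQ σ' hQσ⟩

theorem Code.Runs.block {l : List Stmt} (h : Stmt.Wp I B Q l σ) :
    (Code.block l).Runs I B σ (l.flatMap Stmt.code).length Q := by
  intro P pc rest R hP hσ hR
  obtain ⟨R', σ', hl, hσ', hQ⟩ := h.exists_straight hσ hR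
  exact ⟨_, le_rfl, R', σ', hl hP, hσ', hQ⟩

theorem Code.Runs.seq (hc : c.Runs I B σ S Q) (hd : ∀ σ', Q σ' → d.Runs I B σ' T Q') :
    (c.seq d).Runs I B σ (S + T) Q' := by
  intro P pc rest R hP hσ hR
  rw [Code.compile, List.append_assoc] at hP
  obtain ⟨s, hs, R₁, σ₁, hsteps₁, hσ₁, hQ⟩ := hc hP hσ hR
  obtain ⟨t, ht, R₂, σ₂, hsteps₂, hσ₂, hQ'⟩ :=
    hd σ₁ hQ (drop_add_length hP) hσ₁ hsteps₁.reg_le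
  refine ⟨s + t, by omega, R₂, σ₂, ?_, hσ₂, hQ'⟩
  rw [Code.compile, List.length_append, ← Nat.add_assoc]
  exact hsteps₁.trans hsteps₂

theorem Steps.test {P rest : List Instr} {pc l : ℕ} {R : ℕ → ℕ}
    (hP : P.drop pc = e.code 0 ++ .jumpZero (temp 0) l :: rest) (hσ : Represents R σ)
    (hR : ∀ r, R r ≤ B) (he : e.Safe I B σ) :
    ∃ R', Represents R' σ ∧ Steps P I B ⟨pc, R⟩ ((e.code 0).length + 1)
      ⟨if e.eval I σ = 0 then l else pc + (e.code 0).length + 1, R'⟩ := by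
  obtain ⟨R', h⟩ := e.exists_evaluates hσ hR he (d := 0)
  refine ⟨R', h.represents, (h.straight hP).trans ?_⟩
  have hi := getElem?_of_drop_eq_cons (drop_add_length hP)
  split_ifs with h0
  · exact .jumpZero_of_eq hi h.straight.reg_le (h.value.trans h0)
  · exact .jumpZero_of_ne hi h.straight.reg_le (h.value ▸ h0)

theorem Code.Runs.cond (he : e.Safe I B σ) (hc : e.eval I σ ≠ 0 → c.Runs I B σ T Q)
    (hd : e.eval I σ = 0 → d.Runs I B σ T Q) :
    (Code.cond e c d).Runs I B σ ((e.code 0).length + T + 2) Q := by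
  intro P pc rest R hP hσ hR
  simp only [Code.compile, List.append_assoc, List.cons_append] at hP
  obtain ⟨R₁, hσ₁, htest⟩ := Steps.test hP hσ hR he
  have hPpos := drop_add_length (l := [_]) (drop_add_length hP)
  have hPneg := drop_add_length (l := [_]) (drop_add_length hPpos)
  simp only [List.length_singleton] at hPpos hPneg
  split_ifs at htest with h0
  · obtain ⟨t, ht, R₂, σ₂, hsteps, hσ₂, hQ⟩ := hd h0 hPneg hσ₁ htest.reg_le
    refine ⟨(e.code 0).length + 1 + t, by omega, R₂, σ₂, ?_, hσ₂, hQ⟩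
    convert htest.trans hsteps using 2
    simp only [Code.compile, List.length_append, List.length_cons]
    omega
  · obtain ⟨t, ht, R₂, σ₂, hsteps, hσ₂, hQ⟩ := hc h0 hPpos hσ₁ htest.reg_le
    have hjump := Steps.jump (I := I) (getElem?_of_drop_eq_cons (drop_add_length hPpos))
      hsteps.reg_le
    refine ⟨(e.code 0).length + 1 + t + 1, by omega, R₂, σ₂, ?_, hσ₂, hQ⟩
    convert (htest.trans hsteps).trans hjump using 2
    simp only [Code.compile, List.length_append, List.length_cons]
    omega

theorem Code.Runs.loop {Inv : ℕ → Store → Prop} (he : ∀ m σ, Inv m σ → e.Safe I B σ)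
    (hc : ∀ m σ, Inv m σ → e.eval I σ ≠ 0 → c.Runs I B σ T fun σ' => ∃ m' < m, Inv m' σ')
    {m : ℕ} (h : Inv m σ) :
    (Code.loop e c).Runs I B σ (m * ((e.code 0).length + T + 2) + (e.code 0).length + 1)
      fun σ' => e.eval I σ' = 0 ∧ ∃ m', Inv m' σ' := by
  induction m using Nat.strong_induction_on generalizing σ with | _ m ih
  intro P pc rest R hP hσ hR
  have hP' := hP
  simp only [Code.compile, List.append_assoc, List.cons_append] at hP'
  obtain ⟨R₁, hσ₁, htest⟩ := Steps.test hP' hσ hR (he m σ h)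
  have hPpos := drop_add_length (l := [_]) (drop_add_length hP')
  simp only [List.length_singleton] at hPpos
  split_ifs at htest with h0
  · refine ⟨(e.code 0).length + 1, by omega, R₁, σ, ?_, hσ₁, h0, m, h⟩
    convert htest using 2
    simp only [Code.compile, List.length_append, List.length_cons, List.length_nil]
    omega
  · obtain ⟨t, ht, R₂, σ₂, hbody, hσ₂, m', hm', h'⟩ := hc m σ h h0 hPpos hσ₁ htest.reg_le
    have hjump := Steps.jump (I := I) (getElem?_of_drop_eq_cons (drop_add_length hPpos))
      hbody.reg_le
    obtain ⟨u, hu, R₃, σ₃, hrest, hσ₃, hQ⟩ := ih m' hm' h' hP hσ₂ hjump.reg_le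
    refine ⟨_, ?_, R₃, σ₃, ((htest.trans hbody).trans hjump).trans hrest, hσ₃, hQ⟩
    have hstep := Nat.mul_le_mul_right ((e.code 0).length + T + 2) (Nat.succ_le_of_lt hm')
    rw [Nat.succ_mul] at hstep
    omega

end Runs

/-! ### Reading the edges -/

instance : Coe Var Expr := ⟨.var⟩

section Program

open Var Table

/-- Reads `n`. The first edge starts at input cell `1`. -/
def initBlock : List Stmt :=
  [.set order (.input (.lit 0)), .set left (.sub order (.lit 1)), .set cursor (.lit 1)]

/-- Reads an edge and enters it into the arrays. -/
def edgeBlock : List Stmt :=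
  [.set fst (.input cursor), .set snd (.input (.add cursor (.lit 1))),
    .set cursor (.add cursor (.lit 2)), .set left (.sub left (.lit 1)),
    .put degree fst (.add (.get degree fst) (.lit 1)),
    .put degree snd (.add (.get degree snd) (.lit 1)),
    .put remaining fst (.get degree fst), .put remaining snd (.get degree snd),
    .put nbrSum fst (.add (.get nbrSum fst) snd), .put nbrSum snd (.add (.get nbrSum snd) fst),
    .put size fst (.lit 1), .put size snd (.lit 1)]

/-- Starts the search for leaves at vertex `0`. -/
def startBlock : List Stmt :=
  [.set index (.lit 0), .set vertex (.lit 0), .set total (.lit 0)]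

/-- Goes on with the search for leaves. -/
def nextBlock : List Stmt :=
  [.set index (.add index (.lit 1)), .set vertex index]

/-- The factor `2 deg(x) - 1` of the closed formula. -/
def degreeFactor (x : Var) : Expr :=
  .sub (.add (.get degree x) (.get degree x)) (.lit 1)

/-- Cuts off the leaf `vertex` and goes on to its former neighbour, which may now be a leaf. The
sum of the neighbours of a leaf is its neighbour, and `size` counts the vertex itself together
with everything that has been cut off behind it. -/
def pruneBlock : List Stmt :=
  [.set parent (.get nbrSum vertex), .set weight (.get size vertex),
    .set total (.add total
      (.add (.mul (.mul (degreeFactor parent) weight) weight)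
        (.mul (.mul (degreeFactor vertex) (.sub order weight)) (.sub order weight)))),
    .put remaining vertex (.lit 0),
    .put remaining parent (.sub (.get remaining parent) (.lit 1)),
    .put nbrSum parent (.sub (.get nbrSum parent) vertex),
    .put size parent (.add (.get size parent) weight),
    .set vertex parent]

/-- The distance of the remaining degree of `vertex` from `1`. -/
def leafTest : Expr :=
  .add (.sub (.get remaining vertex) (.lit 1)) (.sub (.lit 1) (.get remaining vertex))

/-- Evaluates the closed formula. -/
def finalBlock : List Stmt :=
  [.set numerator
      (.sub
        (.mul (.sub (.add (.mul (.mul order order) (.lit 3)) (.add order order)) (.lit 2))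
          (.sub order (.lit 1)))
        total),
    .set denominator (.mul (.lit 6) order)]

/-- The loop that reads all edges. -/
def readLoop : Code := .loop left (.block edgeBlock)

/-- The loop that cuts off leaves. When `vertex` is not a leaf, the search goes on at the next
`index`, so that no vertex up to `index` other than `vertex` is ever a leaf. -/
def pruneLoop : Code :=
  .loop (.sub order index) (.cond leafTest (.block nextBlock) (.block pruneBlock))

/-- Reads the edges, cuts off leaves as long as there are any while adding up the contributions
of their edges, and evaluates the closed formula. -/
def code : Code :=
  .seq (.block initBlock) <| .seq readLoop <| .seq (.block startBlock) <| .seq pruneLoop <|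
    .block finalBlock

end Program

section EndSum

variable {n : ℕ}

/-- The sum of `g` over the vertices that `L` joins to `v`. -/
def endSum (g : Fin n → ℕ) (L : List (Fin n × Fin n)) (v : Fin n) : ℕ :=
  (L.map fun e => (if e.1 = v then g e.2 else 0) + if e.2 = v then g e.1 else 0).sum

theorem endSum_append_singleton (g : Fin n → ℕ) (L : List (Fin n × Fin n)) {x y : Fin n}
    (hxy : x ≠ y) (v : Fin n) : endSum g (L ++ [(x, y)]) v =
      if (v : ℕ) = y then endSum g L y + g x else
        if (v : ℕ) = x then endSum g L x + g y else endSum g L v := by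
  simp only [endSum, List.map_append, List.map_cons, List.map_nil, List.sum_append,
    List.sum_singleton, Fin.val_inj]
  rcases eq_or_ne v y with rfl | hy
  · simp [hxy]
  · rcases eq_or_ne v x with rfl | hx
    · simp [hy, hy.symm]
    · simp [hx, hy, hx.symm, hy.symm]

theorem endSum_le {g : Fin n → ℕ} {b : ℕ} (hg : ∀ w, g w ≤ b) (L : List (Fin n × Fin n))
    (v : Fin n) : endSum g L v ≤ L.length * (2 * b) := by
  rw [endSum, ← List.length_map (as := L), ← smul_eq_mul]
  refine List.sum_le_card_nsmul _ _ fun x hx => ?_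
  obtain ⟨e, _, rfl⟩ := List.mem_map.1 hx
  have h1 := hg e.1
  have h2 := hg e.2
  split_ifs <;> omega

theorem toFinset_map_eq_edgeFinset {T : SimpleGraph (Fin n)} [DecidableRel T.Adj]
    {L : List (Fin n × Fin n)} (hL : IsEdgeList T L) :
    (L.map fun e => s(e.1, e.2)).toFinset = T.edgeFinset := by
  ext e
  rw [List.mem_toFinset, hL.2, SimpleGraph.mem_edgeFinset]

theorem endSum_eq {T : SimpleGraph (Fin n)} [DecidableRel T.Adj] {L : List (Fin n × Fin n)}
    (hL : IsEdgeList T L) (g : Fin n → ℕ) (v : Fin n) :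
    endSum g L v = ∑ w ∈ T.neighborFinset v, g w := by
  let F : Fin n → Fin n → ℕ := fun a b => if a = v then g b else 0
  let h : Sym2 (Fin n) → ℕ := Sym2.lift ⟨fun a b => F a b + F b a, fun _ _ => add_comm _ _⟩
  have hedges : endSum g L v = ∑ e ∈ T.edgeFinset, h e := by
    rw [← toFinset_map_eq_edgeFinset hL, List.sum_toFinset _ hL.1, List.map_map]
    rfl
  have hF : ∑ u, ∑ w ∈ T.neighborFinset u, F u w = ∑ w ∈ T.neighborFinset v, g w := by
    rw [Finset.sum_eq_single v (fun u _ hu => by simp [F, hu]) (by simp)]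
    simp [F]
  have hdarts : 2 * ∑ e ∈ T.edgeFinset, h e = 2 * ∑ w ∈ T.neighborFinset v, g w := by
    rw [two_mul_sum_edgeFinset]
    simp only [h, Sym2.lift_mk, Finset.sum_add_distrib]
    rw [← sum_neighborFinset_comm F, hF, two_mul]
  omega

theorem length_add_one_of_isEdgeList {T : SimpleGraph (Fin n)} (hT : T.IsTree)
    {L : List (Fin n × Fin n)} (hL : IsEdgeList T L) : L.length + 1 = n := by
  classical
  have h := hT.card_edgeFinset
  rwa [← toFinset_map_eq_edgeFinset hL, List.toFinset_card_of_nodup hL.1, List.length_map,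
    Fintype.card_fin] at h

theorem encodeInput_getD (L₁ L₂ : List (Fin n × Fin n)) (e : Fin n × Fin n) :
    (encodeInput (L₁ ++ e :: L₂)).getD (1 + 2 * L₁.length) 0 = e.1 ∧
    (encodeInput (L₁ ++ e :: L₂)).getD (1 + 2 * L₁.length + 1) 0 = e.2 := by
  induction L₁ with
  | nil => simp [encodeInput]
  | cons d L₁ ih =>
    simp only [encodeInput, List.cons_append, List.flatMap_cons, List.length_cons,
      List.nil_append, show 1 + 2 * (L₁.length + 1) = (1 + 2 * L₁.length) + 1 + 1 by omega,
      show ∀ k, 1 + k = k + 1 from fun k => Nat.add_comm 1 k, List.getD_cons_succ] at ih ⊢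
    exact ih

end EndSum

/-- The store after the edges `L` have been read from the input. -/
structure HasRead {n : ℕ} (L : List (Fin n × Fin n)) (σ : Store) : Prop where
  order : σ (.var .order) = n
  cursor : σ (.var .cursor) = 1 + 2 * L.length
  degree : ∀ v : Fin n, σ (.entry .degree v) = endSum (fun _ => 1) L v
  remaining : ∀ v : Fin n, σ (.entry .remaining v) = endSum (fun _ => 1) L v
  nbrSum : ∀ v : Fin n, σ (.entry .nbrSum v) = endSum (fun w => w) L v
  size : ∀ v : Fin n, endSum (fun _ => 1) L v ≠ 0 → σ (.entry .size v) = 1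

section Read

variable {n B : ℕ} {L L₁ L₂ : List (Fin n × Fin n)} {x y : Fin n} {σ : Store}

theorem HasRead.wp_edgeBlock (h : HasRead L₁ σ) (hxy : x ≠ y)
    (hlen : (L₁ ++ (x, y) :: L₂).length < n) (hleft : σ (.var .left) = L₂.length + 1)
    (hB : 30 * n ^ 3 ≤ B) :
    Stmt.Wp (encodeInput (L₁ ++ (x, y) :: L₂)) B
      (fun σ' => HasRead (L₁ ++ [(x, y)]) σ' ∧ σ' (.var .left) = L₂.length) edgeBlock σ := by
  obtain ⟨hx, hy⟩ := encodeInput_getD L₁ L₂ (x, y)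
  have hyx : (y : ℕ) ≠ x := Fin.val_ne_of_ne hxy.symm
  simp only [edgeBlock, Stmt.Wp, Stmt.Safe, Stmt.run, Expr.Safe, Expr.eval, Function.update_apply,
    reduceCtorEq, Cell.var.injEq, Cell.entry.injEq, if_true, if_false, true_and, and_true,
    and_false, h.cursor, hx, hy, hyx, hyx.symm, hleft, h.degree, h.nbrSum]
  have hn : n ≤ n ^ 2 := Nat.le_self_pow two_ne_zero n
  have hn' : n ^ 2 ≤ n ^ 3 := Nat.pow_le_pow_right x.pos (by norm_num)
  rw [List.length_append, List.length_cons] at hlen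
  have hdegree : ∀ v, endSum (fun _ => 1) L₁ v ≤ 2 * n := fun v =>
    (endSum_le (fun _ => le_rfl) L₁ v).trans (by omega)
  have hnbrSum : ∀ v, endSum (fun w => (w : ℕ)) L₁ v ≤ 2 * n ^ 2 := fun v =>
    (endSum_le (fun w => w.2.le) L₁ v).trans (by nlinarith)
  have := hdegree x
  have := hdegree y
  have := hnbrSum x
  have := hnbrSum y
  refine ⟨?_, ?_, ?_, ?_, ?_, ?_, ?_, ?_, ?_, ?_, ?_, ?_, ?_, rfl⟩
  iterate 12 omega
  refine ⟨?_, ?_, fun v => ?_, fun v => ?_, fun v => ?_, fun v => ?_⟩ <;>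
    simp only [Function.update_apply, reduceCtorEq, Cell.entry.injEq, Cell.var.injEq, true_and,
      false_and, if_true, if_false, endSum_append_singleton _ _ hxy, h.order, h.degree,
      h.remaining, h.nbrSum, List.length_append, List.length_singleton]
  · omega
  · intro hv
    split_ifs at hv ⊢
    · rfl
    · rfl
    · exact h.size v hv

theorem runs_readLoop (hne : ∀ e ∈ L, e.1 ≠ e.2) (hlen : L.length < n) (hB : 30 * n ^ 3 ≤ B)
    (h : HasRead (n := n) [] σ) (hleft : σ (.var .left) = L.length) :
    readLoop.Runs (encodeInput L) B σ (200 * n) (HasRead L) := by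
  let Inv (m : ℕ) (σ : Store) : Prop :=
    ∃ L₁ L₂, L₁ ++ L₂ = L ∧ L₂.length = m ∧ HasRead L₁ σ ∧ σ (.var .left) = m
  have hstep : ∀ m σ, Inv m σ → Expr.eval (encodeInput L) σ Var.left ≠ 0 →
      (Code.block edgeBlock).Runs (encodeInput L) B σ (edgeBlock.flatMap Stmt.code).length
        fun σ' => ∃ m' < m, Inv m' σ' := by
    rintro m σ ⟨L₁, _ | ⟨⟨x, y⟩, L₂⟩, rfl, rfl, h, hleft⟩ h0
    · exact absurd hleft h0
    · exact Code.Runs.mono (.block (h.wp_edgeBlock (hne (x, y) (by simp)) hlen hleft hB)) le_rfl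
        fun σ' ⟨h', hleft'⟩ => ⟨L₂.length, Nat.lt_succ_self _, L₁ ++ [(x, y)], L₂,
          by simp, rfl, h', hleft'⟩
  have hsafe : ∀ m σ, Inv m σ → Expr.Safe (encodeInput L) B σ Var.left := fun _ _ _ => trivial
  refine Code.Runs.mono (.loop hsafe hstep ⟨[], L, rfl, rfl, h, hleft⟩) ?_ ?_
  · have htest : (Expr.code 0 Var.left).length = 2 := rfl
    have hbody : (edgeBlock.flatMap Stmt.code).length = 134 := rfl
    rw [htest, hbody]
    omega
  · rintro σ' ⟨h0, m, L₁, L₂, rfl, rfl, h', hleft'⟩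
    obtain rfl : L₂ = [] := List.length_eq_zero_iff.1 (hleft'.symm.trans h0)
    rwa [List.append_nil]

theorem wp_initBlock (hlen : L.length + 1 = n) (hB : 30 * n ^ 3 ≤ B) :
    Stmt.Wp (encodeInput L) B (fun σ => HasRead (n := n) [] σ ∧ σ (.var .left) = L.length) initBlock
      fun _ => 0 := by
  have hn : n ≤ n ^ 3 := Nat.le_self_pow three_ne_zero n
  have horder : (encodeInput L).getD 0 0 = n := rfl
  simp only [initBlock, Stmt.Wp, Stmt.Safe, Stmt.run, Expr.Safe, Expr.eval, Function.update_apply,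
    reduceCtorEq, Cell.var.injEq, if_true, if_false, true_and, horder]
  refine ⟨⟨?_, ?_⟩, ?_, ?_, ?_, ?_⟩
  iterate 4 omega
  · constructor <;> simp [endSum]
  · omega

end Read

/-! ### Cutting off the leaves -/

section Leaf

variable {V : Type*} [Fintype V] {G : SimpleGraph V} [DecidableRel G.Adj]

theorem eq_bot_of_degree_ne_one (hG : G.IsAcyclic) (h : ∀ v, G.degree v ≠ 1) : G = ⊥ := by
  by_contra hne
  obtain ⟨a, b, hab⟩ := SimpleGraph.ne_bot_iff_exists_adj.1 hne
  have : Nonempty V := ⟨a⟩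
  obtain ⟨u, v, p, hp, hmax⟩ := SimpleGraph.Walk.exists_isPath_forall_isPath_length_le_length G
  have hnil : ¬p.Nil := by
    intro hnil
    have := hmax _ _ _ (SimpleGraph.Walk.IsPath.of_adj hab)
    simp [SimpleGraph.Walk.length_eq_zero_iff.2 hnil] at this
  refine h u (SimpleGraph.degree_eq_one_iff_existsUnique_adj.2
    ⟨p.snd, p.adj_snd hnil, fun w hadj => hG.eq_snd_of_adj_start hp hadj ?_⟩)
  by_contra hw
  have := hmax _ _ _ (hp.cons (h := hadj.symm) hw)
  rw [SimpleGraph.Walk.length_cons] at this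
  omega

variable {v p : V} [DecidableRel (G.deleteIncidenceSet v).Adj]

theorem card_edgeFinset_deleteIncidenceSet_lt (h : G.Adj v p) :
    (G.deleteIncidenceSet v).edgeFinset.card < G.edgeFinset.card := by
  refine Finset.card_lt_card (SimpleGraph.edgeFinset_ssubset_edgeFinset.2
    ((G.deleteIncidenceSet_le v).lt_of_ne fun heq => ?_))
  rw [← heq, SimpleGraph.deleteIncidenceSet_adj] at h
  exact h.2.1 rfl

variable [DecidableEq V]

theorem neighborFinset_deleteIncidenceSet (j : V) :
    (G.deleteIncidenceSet v).neighborFinset j =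
      if j = v then ∅ else (G.neighborFinset j).erase v := by
  ext u
  split_ifs with hj <;> simp [SimpleGraph.deleteIncidenceSet_adj, hj, and_comm]

/-- The summands on the left other than the first are the terms of the edge between the leaf `v`
and its neighbour `p`. -/
theorem sum_neighborFinset_deleteIncidenceSet {M : Type*} [AddCommMonoid M]
    (hv : G.neighborFinset v = {p}) (g : V → M) (j : V) :
    ∑ u ∈ (G.deleteIncidenceSet v).neighborFinset j, g u +
      ((if j = p then g v else 0) + if j = v then g p else 0) = ∑ u ∈ G.neighborFinset j, g u := by
  have hadj (j : V) : v ∈ G.neighborFinset j ↔ j = p := by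
    rw [SimpleGraph.mem_neighborFinset, G.adj_comm, ← SimpleGraph.mem_neighborFinset, hv,
      Finset.mem_singleton]
  have hpv : v ≠ p := fun h => G.irrefl ((G.mem_neighborFinset v v).1 ((hadj v).2 h))
  rw [neighborFinset_deleteIncidenceSet]
  rcases eq_or_ne j v with rfl | hjv
  · simp [hpv, hv]
  · rcases eq_or_ne j p with rfl | hjp
    · simp [hjv, Finset.sum_erase_add _ _ ((hadj j).2 rfl)]
    · simp [hjv, hjp, Finset.erase_eq_of_notMem (mt (hadj j).1 hjp)]

theorem degree_deleteIncidenceSet (hv : G.neighborFinset v = {p}) (j : V) :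
    (G.deleteIncidenceSet v).degree j =
      if j = p then G.degree p - 1 else if j = v then 0 else G.degree j := by
  have h := sum_neighborFinset_deleteIncidenceSet hv (fun _ => 1) j
  simp only [← Finset.card_eq_sum_ones, SimpleGraph.card_neighborFinset_eq_degree] at h
  have hdeg : G.degree v = 1 := by
    rw [← G.card_neighborFinset_eq_degree, hv, Finset.card_singleton]
  split_ifs at h ⊢ with hp hjv hjv <;> subst_vars <;> omega

omit [DecidableEq V] in
theorem sum_sum_neighborFinset_deleteIncidenceSet {M : Type*} [AddCommMonoid M]
    (hv : G.neighborFinset v = {p}) (F : V → V → M) :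
    ∑ j, ∑ u ∈ (G.deleteIncidenceSet v).neighborFinset j, F j u + (F p v + F v p) =
      ∑ j, ∑ u ∈ G.neighborFinset j, F j u := by
  classical
  simp only [← sum_neighborFinset_deleteIncidenceSet hv, Finset.sum_add_distrib]
  simp

end Leaf

variable {n : ℕ} {T H : SimpleGraph (Fin n)} [DecidableRel T.Adj] [DecidableRel H.Adj]

/-- The term of the closed formula that belongs to the edge from `u` to `c`. -/
noncomputable def dartTerm (T : SimpleGraph (Fin n)) [DecidableRel T.Adj] (u c : Fin n) : ℕ :=
  (T.degree u + T.degree u - 1) * subtreeSize T u c * subtreeSize T u c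

theorem mul_subtreeSize_le_dartTerm (u c : Fin n) :
    (T.degree u + T.degree u - 1) * subtreeSize T u c ≤ dartTerm T u c := by
  rw [dartTerm, mul_assoc]
  exact Nat.mul_le_mul_left _ (Nat.le_mul_self _)

/-- The sum that the closed formula subtracts. -/
noncomputable def dartSum (T : SimpleGraph (Fin n)) [DecidableRel T.Adj] : ℕ :=
  ∑ u, ∑ c ∈ T.neighborFinset u, dartTerm T u c

/-- The store while leaves are cut off from the tree `T`, when the forest `H` remains. -/
structure PruneInv (T H : SimpleGraph (Fin n)) [DecidableRel T.Adj] [DecidableRel H.Adj]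
    (σ : Store) : Prop where
  le : H ≤ T
  order : σ (.var .order) = n
  range : σ (.var .index) < n ∧ σ (.var .vertex) < n ∨
    σ (.var .index) = n ∧ σ (.var .vertex) = n
  degree : ∀ j : Fin n, σ (.entry .degree j) = T.degree j
  remaining : ∀ j : Fin n, σ (.entry .remaining j) = H.degree j
  nbrSum : ∀ j : Fin n, H.degree j ≠ 0 →
    σ (.entry .nbrSum j) = ∑ u ∈ H.neighborFinset j, (u : ℕ)
  size : ∀ j : Fin n, H.degree j ≠ 0 →
    σ (.entry .size j) + ∑ c ∈ H.neighborFinset j, subtreeSize T j c = n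
  total : σ (.var .total) + ∑ u, ∑ c ∈ H.neighborFinset u, dartTerm T u c = dartSum T
  leaf : ∀ j : Fin n, j ≤ σ (.var .index) → j ≠ σ (.var .vertex) → H.degree j ≠ 1

section Prune

variable {B : ℕ} {I : List ℕ} {L : List (Fin n × Fin n)} {σ : Store} {v p : Fin n}

theorem HasRead.wp_startBlock (hT : T.IsTree) (hL : IsEdgeList T L) (h : HasRead L σ) :
    Stmt.Wp I B (fun σ' => PruneInv T T σ' ∧ σ' (.var .index) = 0) startBlock σ := by
  have hn : 0 < n := hT.1.nonempty.elim Fin.pos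
  have hdegree (j : Fin n) : endSum (fun _ => 1) L j = T.degree j := by
    rw [endSum_eq hL, ← Finset.card_eq_sum_ones, T.card_neighborFinset_eq_degree]
  simp only [startBlock, Stmt.Wp, Stmt.Safe, Stmt.run, Expr.Safe, Expr.eval, zero_le, true_and]
  refine ⟨⟨le_rfl, ?_, ?_, fun j => ?_, fun j => ?_, fun _ _ => ?_, fun j hj => ?_, ?_,
    fun j hj hj' => absurd (Nat.le_zero.1 hj) hj'⟩, ?_⟩ <;>
    simp only [Function.update_apply, reduceCtorEq, Cell.var.injEq, if_true, if_false, h.order,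
      h.degree, h.remaining, h.nbrSum, hdegree]
  · exact .inl ⟨hn, hn⟩
  · exact endSum_eq hL ..
  · rw [h.size j (by rwa [hdegree]), one_add_sum_subtreeSize hT, Fintype.card_fin]
  · rw [dartSum, zero_add]

theorem PruneInv.wp_nextBlock (h : PruneInv T H σ) (hv : σ (.var .vertex) = v)
    (hdeg : H.degree v ≠ 1) (hindex : σ (.var .index) < n) (hB : n ≤ B) :
    Stmt.Wp I B (fun σ' => PruneInv T H σ' ∧ σ' (.var .index) = σ (.var .index) + 1)
      nextBlock σ := by
  simp only [nextBlock, Stmt.Wp, Stmt.Safe, Stmt.run, Expr.Safe, Expr.eval, true_and,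
    Function.update_self]
  refine ⟨by omega, ⟨h.le, ?_, ?_, fun j => ?_, fun j => ?_, fun j => ?_, fun j => ?_, ?_,
    fun j hj hj' => ?_⟩, ?_⟩
  all_goals simp only [Function.update_apply, reduceCtorEq, Cell.var.injEq, if_true, if_false,
    h.order, h.degree, h.remaining] at *
  · omega
  · exact h.nbrSum j
  · exact h.size j
  · exact h.total
  · rcases eq_or_ne j v with rfl | hjv
    · exact hdeg
    · exact h.leaf j (by omega) (by rw [hv]; exact Fin.val_ne_of_ne hjv)

theorem PruneInv.nbrSum_of_leaf (h : PruneInv T H σ) (hv : H.neighborFinset v = {p}) :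
    σ (.entry .nbrSum v) = p := by
  rw [h.nbrSum v (by rw [← H.card_neighborFinset_eq_degree, hv]; simp), hv, Finset.sum_singleton]

theorem PruneInv.size_of_leaf (h : PruneInv T H σ) (hT : T.IsTree)
    (hv : H.neighborFinset v = {p}) :
    σ (.entry .size v) = subtreeSize T p v ∧ n - subtreeSize T p v = subtreeSize T v p := by
  have hadj : T.Adj v p := h.le ((H.mem_neighborFinset v p).1 (hv ▸ Finset.mem_singleton_self p))
  have hsize := h.size v (by rw [← H.card_neighborFinset_eq_degree, hv]; simp)
  have hadd := subtreeSize_add_subtreeSize hT hadj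
  rw [hv, Finset.sum_singleton] at hsize
  rw [Fintype.card_fin] at hadd
  omega

theorem PruneInv.deleteIncidenceSet [DecidableRel (H.deleteIncidenceSet v).Adj] {σ' : Store}
    (h : PruneInv T H σ) (hvertex : σ (.var .vertex) = v) (hv : H.neighborFinset v = {p})
    (hindex : σ (.var .index) < n) (hindex' : σ' (.var .index) = σ (.var .index))
    (hvertex' : σ' (.var .vertex) = p) (horder : σ' (.var .order) = n)
    (hdegree : ∀ j : Fin n, σ' (.entry .degree j) = T.degree j)
    (hremaining : ∀ j : Fin n, σ' (.entry .remaining j) =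
      if j = p then H.degree p - 1 else if j = v then 0 else H.degree j)
    (hnbrSum : ∀ j : Fin n, σ' (.entry .nbrSum j) =
      if j = p then σ (.entry .nbrSum p) - v else σ (.entry .nbrSum j))
    (hsize : ∀ j : Fin n, σ' (.entry .size j) =
      if j = p then σ (.entry .size p) + subtreeSize T p v else σ (.entry .size j))
    (htotal : σ' (.var .total) = σ (.var .total) + (dartTerm T p v + dartTerm T v p)) :
    PruneInv T (H.deleteIncidenceSet v) σ' := by
  have hadj : H.Adj v p := (H.mem_neighborFinset v p).1 (hv ▸ Finset.mem_singleton_self p)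
  have hp : H.degree p ≠ 0 := (H.degree_pos_iff_exists_adj p).2 ⟨v, hadj.symm⟩ |>.ne'
  have hdeg := degree_deleteIncidenceSet hv
  have hne {j : Fin n} (hj : (H.deleteIncidenceSet v).degree j ≠ 0) :
      j ≠ v ∧ H.degree j ≠ 0 := by
    rw [hdeg] at hj
    grind [hadj.ne]
  refine ⟨(H.deleteIncidenceSet_le v).trans h.le, horder, .inl ⟨hindex' ▸ hindex, hvertex' ▸ p.2⟩,
    hdegree, fun j => (hremaining j).trans (hdeg j).symm, fun j hj => ?_, fun j hj => ?_, ?_,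
    fun j hj hj' => ?_⟩
  · obtain ⟨hjv, hj⟩ := hne hj
    have hsum := sum_neighborFinset_deleteIncidenceSet hv (fun u => (u : ℕ)) j
    rw [if_neg hjv] at hsum
    have := h.nbrSum j hj
    rw [hnbrSum]
    split_ifs at hsum ⊢ with hjp <;> subst_vars <;> omega
  · obtain ⟨hjv, hj⟩ := hne hj
    have hsum := sum_neighborFinset_deleteIncidenceSet hv (subtreeSize T j) j
    rw [if_neg hjv] at hsum
    have := h.size j hj
    rw [hsize]
    split_ifs at hsum ⊢ with hjp <;> subst_vars <;> omega
  · rw [htotal, ← h.total, ← sum_sum_neighborFinset_deleteIncidenceSet hv (dartTerm T)]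
    omega
  · rw [hvertex', Fin.val_ne_iff] at hj'
    rw [hdeg, if_neg hj']
    split_ifs with hjv
    · exact zero_ne_one
    · exact h.leaf j (hindex' ▸ hj) (by rwa [hvertex, Fin.val_ne_iff])

theorem PruneInv.wp_pruneBlock [DecidableRel (H.deleteIncidenceSet v).Adj] (h : PruneInv T H σ)
    (hT : T.IsTree) (hvertex : σ (.var .vertex) = v) (hv : H.neighborFinset v = {p})
    (hindex : σ (.var .index) < n) (hB : 30 * n ^ 3 ≤ B) (hdartSum : dartSum T ≤ B) :
    Stmt.Wp I B (fun σ' => PruneInv T (H.deleteIncidenceSet v) σ' ∧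
      σ' (.var .index) = σ (.var .index)) pruneBlock σ := by
  have hnbr := h.nbrSum_of_leaf hv
  obtain ⟨hsize, hsub⟩ := h.size_of_leaf hT hv
  have hadj : H.Adj v p := (H.mem_neighborFinset v p).1 (hv ▸ Finset.mem_singleton_self p)
  have hp : H.degree p ≠ 0 := (H.degree_pos_iff_exists_adj p).2 ⟨v, hadj.symm⟩ |>.ne'
  have hpv : (p : ℕ) ≠ v := Fin.val_ne_of_ne hadj.ne'
  have htotal := h.total
  rw [← sum_sum_neighborFinset_deleteIncidenceSet hv] at htotal
  have hsum := sum_neighborFinset_deleteIncidenceSet hv (subtreeSize T p) p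
  rw [if_pos rfl, if_neg hadj.ne', add_zero] at hsum
  have := h.size p hp
  have hn : n ≤ n ^ 3 := Nat.le_self_pow three_ne_zero n
  have hpdeg := T.degree_lt_card_verts p
  have hvdeg := T.degree_lt_card_verts v
  rw [Fintype.card_fin] at hpdeg hvdeg
  have hterm (u c : Fin n) : (T.degree u + T.degree u - 1) * subtreeSize T u c *
    subtreeSize T u c = dartTerm T u c := rfl
  have := mul_subtreeSize_le_dartTerm (T := T) p v
  have := mul_subtreeSize_le_dartTerm (T := T) v p
  simp only [pruneBlock, degreeFactor, Stmt.Wp, Stmt.Safe, Stmt.run, Expr.Safe, Expr.eval,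
    Function.update_apply, reduceCtorEq, Cell.var.injEq, Cell.entry.injEq, if_true, if_false,
    true_and, and_true, and_false, h.order, hvertex, hnbr, hsize, h.degree, hsub, h.remaining,
    hpv, hterm]
  refine ⟨by omega, by omega, by omega, by omega, by omega, by omega, by omega, ?_⟩
  refine h.deleteIncidenceSet hvertex hv hindex ?_ ?_ ?_ (fun j => ?_) (fun j => ?_)
    (fun j => ?_) (fun j => ?_) ?_ <;>
    simp only [Function.update_apply, reduceCtorEq, Cell.var.injEq, Cell.entry.injEq,
    true_and, false_and, if_true, if_false, h.order, h.degree, h.remaining, Fin.val_inj]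

end Prune

section Loop

variable {n B : ℕ} {T H : SimpleGraph (Fin n)} [DecidableRel T.Adj] [DecidableRel H.Adj]
  {I : List ℕ} {σ : Store}

theorem PruneInv.total_eq_dartSum (h : PruneInv T H σ) (hT : T.IsTree)
    (hindex : n ≤ σ (.var .index)) : σ (.var .total) = dartSum T := by
  have hleaf (v : Fin n) : H.degree v ≠ 1 := by
    have := h.range
    exact h.leaf v (by omega) (by omega)
  have hbot := eq_bot_of_degree_ne_one (hT.isAcyclic.anti h.le) hleaf
  have hnbr (v : Fin n) : H.neighborFinset v = ∅ := by
    ext w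
    simp [hbot]
  simpa [hnbr] using h.total

/-- The loop invariant of `pruneLoop`. At most `m` passes are left, as each of them cuts off an edge
or moves `index`. -/
def PruneState (T : SimpleGraph (Fin n)) [DecidableRel T.Adj] (m : ℕ) (σ : Store) : Prop :=
  ∃ (H : SimpleGraph (Fin n)) (_ : DecidableRel H.Adj),
    PruneInv T H σ ∧ H.edgeFinset.card + (n - σ (.var .index)) = m

theorem PruneState.runs_body {m : ℕ} (h : PruneState T m σ) (hT : T.IsTree)
    (hindex : σ (.var .index) < n) (hB : 30 * n ^ 3 ≤ B) (hdartSum : dartSum T ≤ B) :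
    (Code.cond leafTest (.block nextBlock) (.block pruneBlock)).Runs I B σ 159
      fun σ' => ∃ m' < m, PruneState T m' σ' := by
  classical
  obtain ⟨H, _, h, rfl⟩ := h
  have hn : n ≤ n ^ 3 := Nat.le_self_pow three_ne_zero n
  obtain ⟨v, hv⟩ : ∃ v : Fin n, σ (.var .vertex) = v := by
    have := h.range
    exact ⟨⟨_, by omega⟩, rfl⟩
  have hdeg := H.degree_lt_card_verts v
  rw [Fintype.card_fin] at hdeg
  have hsafe : leafTest.Safe I B σ := by
    simp only [leafTest, Expr.Safe, Expr.eval, hv, h.remaining, true_and]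
    omega
  have htest : leafTest.eval I σ = H.degree v - 1 + (1 - H.degree v) := by
    simp only [leafTest, Expr.eval, hv, h.remaining]
  refine .cond (T := 138) hsafe (fun h0 => ?_) fun h0 => ?_
  · refine Code.Runs.mono (.block (h.wp_nextBlock hv (by omega) hindex (by omega))) (by decide) ?_
    rintro σ' ⟨h', hindex'⟩
    exact ⟨_, by omega, H, _, h', rfl⟩
  · obtain ⟨p, hp⟩ : ∃ p, H.neighborFinset v = {p} := by
      rw [← Finset.card_eq_one, H.card_neighborFinset_eq_degree]
      omega
    have hadj : H.Adj v p := (H.mem_neighborFinset v p).1 (hp ▸ Finset.mem_singleton_self p)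
    have hlt := card_edgeFinset_deleteIncidenceSet_lt hadj
    refine Code.Runs.mono (.block (h.wp_pruneBlock hT hv hp hindex hB hdartSum)) le_rfl ?_
    rintro σ' ⟨h', hindex'⟩
    exact ⟨_, by omega, _, _, h', rfl⟩

theorem runs_pruneLoop (hT : T.IsTree) (hB : 30 * n ^ 3 ≤ B) (hdartSum : dartSum T ≤ B)
    (h : PruneInv T T σ) (hindex : σ (.var .index) = 0) :
    pruneLoop.Runs I B σ (340 * n) fun σ' =>
      σ' (.var .order) = n ∧ σ' (.var .total) = dartSum T := by
  have heval : ∀ m σ, PruneState T m σ →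
      (Expr.sub Var.order Var.index).eval I σ = n - σ (.var .index) := by
    rintro m σ ⟨H, _, h, -⟩
    simp only [Expr.eval, h.order]
  refine Code.Runs.mono (.loop (e := .sub Var.order Var.index) (Inv := PruneState T)
    (fun _ _ _ => ⟨trivial, trivial⟩) (fun m σ h h0 => h.runs_body hT ?_ hB hdartSum)
    ⟨T, _, h, rfl⟩) ?_ ?_
  · rw [heval m σ h] at h0
    omega
  · have htest : ((Expr.sub Var.order Var.index).code 0).length = 5 := rfl
    have := hT.card_edgeFinset
    rw [Fintype.card_fin] at this
    rw [htest, hindex]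
    omega
  · rintro σ' ⟨h0, m, hm⟩
    rw [heval m σ' hm] at h0
    obtain ⟨H, _, h, -⟩ := hm
    exact ⟨h.order, h.total_eq_dartSum hT (by omega)⟩

end Loop

/-! ### The value computed by the program -/

theorem expectedPlanarD_nonneg {V : Type*} [Fintype V] [DecidableEq V] (T : SimpleGraph V)
    [DecidableRel T.Adj] : 0 ≤ expectedPlanarD T := by
  refine Finset.expect_nonneg fun π _ => Finset.sum_nonneg fun e _ => ?_
  induction e using Sym2.ind with
  | _ a b => exact abs_nonneg _

section Program

variable {n B : ℕ} {T : SimpleGraph (Fin n)} [DecidableRel T.Adj] {I : List ℕ} {σ : Store}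

theorem cast_dartSum : (dartSum T : ℚ) =
    ∑ v, (2 * (T.degree v : ℚ) - 1) * ∑ u ∈ T.neighborFinset v, (subtreeSize T v u : ℚ) ^ 2 := by
  simp only [dartSum, dartTerm, Nat.cast_sum, Finset.mul_sum]
  refine Finset.sum_congr rfl fun v _ => Finset.sum_congr rfl fun u hu => ?_
  have hpos : 0 < T.degree v :=
    (T.degree_pos_iff_exists_adj v).2 ⟨u, (T.mem_neighborFinset v u).1 hu⟩
  rw [Nat.cast_mul, Nat.cast_mul, Nat.cast_sub (by omega)]
  push_cast
  ring

theorem expectedPlanarD_eq_div (hT : T.IsTree) :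
    dartSum T ≤ (n * n * 3 + (n + n) - 2) * (n - 1) ∧ expectedPlanarD T =
      (((n * n * 3 + (n + n) - 2) * (n - 1) - dartSum T : ℕ) : ℚ) / ((6 * n : ℕ) : ℚ) := by
  have hn : 0 < n := hT.1.nonempty.elim Fin.pos
  have : (0 : ℚ) < n := Nat.cast_pos.2 hn
  have hcast : (((n * n * 3 + (n + n) - 2) * (n - 1) : ℕ) : ℚ) =
      ((n : ℚ) - 1) * (3 * (n : ℚ) ^ 2 + 2 * (n : ℚ) - 2) := by
    rw [Nat.cast_mul, Nat.cast_sub (by omega), Nat.cast_sub hn]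
    push_cast
    ring
  have hE : expectedPlanarD T =
      ((((n * n * 3 + (n + n) - 2) * (n - 1) : ℕ) : ℚ) - dartSum T) / (6 * n) := by
    rw [expectedPlanarD_eq hT (Fintype.card_fin n), ← cast_dartSum, hcast]
    field_simp
  have hle : dartSum T ≤ (n * n * 3 + (n + n) - 2) * (n - 1) := by
    have hnonneg := expectedPlanarD_nonneg T
    rw [hE, le_div_iff₀ (by positivity), zero_mul, sub_nonneg] at hnonneg
    exact_mod_cast hnonneg
  refine ⟨hle, ?_⟩
  rw [hE, Nat.cast_sub hle]
  push_cast
  ring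

theorem main_term_le (n : ℕ) : (n * n * 3 + (n + n) - 2) * (n - 1) ≤ 5 * n ^ 3 := by
  have hn : n ≤ n * n := Nat.le_mul_self n
  calc (n * n * 3 + (n + n) - 2) * (n - 1) ≤ (5 * (n * n)) * n :=
        Nat.mul_le_mul (by omega) (by omega)
    _ = 5 * n ^ 3 := by ring

theorem wp_finalBlock {s : ℕ} (horder : σ (.var .order) = n) (htotal : σ (.var .total) = s)
    (hn : 0 < n) (hB : 30 * n ^ 3 ≤ B) :
    Stmt.Wp I B (fun σ' => σ' (.var .numerator) = (n * n * 3 + (n + n) - 2) * (n - 1) - s ∧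
      σ' (.var .denominator) = 6 * n) finalBlock σ := by
  have hsq : n * n ≤ n ^ 3 := by
    rw [← sq]
    exact Nat.pow_le_pow_right hn (by norm_num)
  have hle : n ≤ n * n := Nat.le_mul_self n
  have hmain := main_term_le n
  simp only [finalBlock, Stmt.Wp, Stmt.Safe, Stmt.run, Expr.Safe, Expr.eval,
    Function.update_apply, reduceCtorEq, Cell.var.injEq, if_true, if_false, true_and, and_true,
    horder, htotal]
  omega

/-- The machine program: the compiled `code`. -/
def program : List Instr :=
  code.compile 0

theorem runs_code (hT : T.IsTree) {L : List (Fin n × Fin n)} (hL : IsEdgeList T L)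
    (hB : 30 * n ^ 3 ≤ B) :
    code.Runs (encodeInput L) B (fun _ => 0) (600 * n) fun σ =>
      σ (.var .numerator) = (n * n * 3 + (n + n) - 2) * (n - 1) - dartSum T ∧
        σ (.var .denominator) = 6 * n := by
  have hlen := length_add_one_of_isEdgeList hT hL
  have hne (e) (he : e ∈ L) : e.1 ≠ e.2 :=
    (T.mem_edgeSet.1 ((hL.2 _).1 (List.mem_map_of_mem he))).ne
  have hdartSum : dartSum T ≤ B := by
    have := (expectedPlanarD_eq_div hT).1.trans (main_term_le n)
    omega
  refine Code.Runs.mono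
    (.seq (.block (wp_initBlock hlen hB)) fun _ h₁ =>
      .seq (runs_readLoop hne (by omega) hB h₁.1 h₁.2) fun _ h₂ =>
      .seq (.block (h₂.wp_startBlock hT hL)) fun _ h₃ =>
      .seq (runs_pruneLoop hT hB hdartSum h₃.1 h₃.2) fun _ h₄ =>
      .block (wp_finalBlock h₄.1 h₄.2 (by omega) hB)) ?_ fun _ h => h
  have hinit : (initBlock.flatMap Stmt.code).length = 13 := rfl
  have hstart : (startBlock.flatMap Stmt.code).length = 9 := rfl
  have hfinal : (finalBlock.flatMap Stmt.code).length = 31 := rfl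
  omega

theorem program_computesWithin (hT : T.IsTree) {L : List (Fin n × Fin n)}
    (hL : IsEdgeList T L) :
    ComputesWithin program (encodeInput L) (600 * n) (600 * n ^ 3)
      ((n * n * 3 + (n + n) - 2) * (n - 1) - dartSum T) (6 * n) := by
  have hprogram : program.drop 0 = code.compile 0 ++ [] := (List.append_nil _).symm
  obtain ⟨t, ht, R, σ, hsteps, hσ, hnum, hden⟩ :=
    runs_code hT hL (B := 600 * n ^ 3) (by omega) hprogram (R := fun _ => 0) (fun _ => rfl)
      fun _ => Nat.zero_le _
  have hpc : program.length ≤ 0 + (code.compile 0).length := by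
    simp only [program, Nat.zero_add, le_refl]
  refine hsteps.computesWithin hpc ?_ ?_ ht
  · exact (hσ (.var .numerator)).trans hnum
  · exact (hσ (.var .denominator)).trans hden

end Program

end PlanarLin

theorem proposition2 :
    -- the closed formula, for every free tree
    (∀ (V : Type*) [Fintype V] [DecidableEq V] (T : SimpleGraph V) [DecidableRel T.Adj] (n : ℕ),
      T.IsTree → Fintype.card V = n →
      PlanarLin.expectedPlanarD T =
        ((n : ℚ) - 1) * (3 * (n : ℚ) ^ 2 + 2 * (n : ℚ) - 2) / (6 * (n : ℚ)) -
          1 / (6 * (n : ℚ)) *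
            ∑ v : V, (2 * (T.degree v : ℚ) - 1) *
              ∑ u ∈ T.neighborFinset v, (PlanarLin.subtreeSize T v u : ℚ) ^ 2) ∧
    -- linear time: one program computes the value as a fraction, in `O(n)` steps on words of
    -- `O(log n)` bits, from any list of the edges of the tree
    (∃ (P : List PlanarLin.Instr) (c k : ℕ),
      ∀ (n : ℕ) (T : SimpleGraph (Fin n)) [DecidableRel T.Adj] (L : List (Fin n × Fin n)),
        T.IsTree → PlanarLin.IsEdgeList T L →
        ∃ a b : ℕ, b ≠ 0 ∧ PlanarLin.expectedPlanarD T = (a : ℚ) / (b : ℚ) ∧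
          PlanarLin.ComputesWithin P (PlanarLin.encodeInput L) (c * n) (c * n ^ k) a b) := by
  refine ⟨fun V _ _ T _ n hT hn => PlanarLin.expectedPlanarD_eq hT hn,
    PlanarLin.program, 600, 3, fun n T _ L hT hL => ⟨_, _, ?_,
      (PlanarLin.expectedPlanarD_eq_div hT).2, PlanarLin.program_computesWithin hT hL⟩⟩
  have hlen := PlanarLin.length_add_one_of_isEdgeList hT hL
  omega
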